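/- Let $O$ be a complete discrete valuation ring with perfect residue class field, $\pi$ a uniformizer, $K$ the fraction field of $O$, $k$ an algebraic closure of the residue class field, and let $0<r<n$ be integers. Let $e_1,\dots,e_n$ be the standard basis of $K^n$ and, for $0\le i\le n-1$, let $\Lambda_i\subset K^n$ be the free $O$-module with basis $e^i_1=\pi^{-1}e_1,\dots,e^i_i=\pi^{-1}e_i,\ e^i_{i+1}=e_{i+1},\dots,e^i_n=e_n$, so that there is a chain $$\Lambda_0\to\Lambda_1\to\cdots\to\Lambda_{n-1}\xrightarrow{\ \pi\ }\Lambda_0$$ (inclusions, followed by multiplication by $\pi$). For an $O$-scheme $S$ put $\Lambda_{i,S}=\Lambda_i\otimes_O\mathcal O_S$. The standard local model $M^{\mathrm{loc}}$ is the $O$-scheme that represents the functor sending an $O$-scheme $S$ to the set of families $(\mathcal F_i)_{0\le i\le n-1}$ of $\mathcal O_S$-submodules $\mathcal F_i\subseteq\Lambda_{i,S}$ which are locally free of rank $r$, Zariski-locally on $S$ direct summands, and such that each map of the chain sends $\mathcal F_i$ into $\mathcal F_{i+1}$ (with $\mathcal F_n:=\mathcal F_0$). Let $\omega_i=(1^i,0^{n-i})$,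 and let $\tau_i=(1^{r+i},0^{n-r-i})$ if $r+i\le n$ and $\tau_i=(2^{r+i-n},1^{2n-r-i})$ if $r+i>n$ $(0\le i\le n-1)$. Let $U_\tau\subseteq M^{\mathrm{loc}}$ be the open subset of those points $(\mathcal F_i)_i$ for which, for all $i$, the quotient $\Lambda_i/\mathcal F_i$ is generated by the $e^i_j$ with $\omega_i(j)=\tau_i(j)$. For $0\le i\le n-1$ let $A_i$ be the $(n-r)\times(n-r)$-matrix $$A_i=\begin{pmatrix} a^i_1&1&&\\ a^i_2&0&\ddots&\\ \vdots&&\ddots&1\\ a^i_{n-r}&&&0\end{pmatrix},$$ where the $a^i_\kappa$ are indeterminates: the first column is $(a^i_1,\dots,a^i_{n-r})$, the entries just above the diagonal are $1$ and all other entries are $0$ (for $n-r=1$ it is the $1\times1$-matrix $(a^i_1)$). Then the functor above is representable, so $M^{\mathrm{loc}}$ exists; $U_\tau$ contains the worst singular point of the special fibre, i.e. the $k$-valued point $(\mathcal F_i)_i$ for which $\mathcal F_i$ is spanned by the $e^i_j$ with $\tau_i(j)=\omega_i(j)+1$; and $U_\tau$ is isomorphic, as an $O$-scheme, to $$\operatorname{Spec}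 O[a^i_\kappa;\ i=0,\dots,n-1,\ \kappa=1,\dots,n-r]/I,$$ where $I$ is the ideal generated by the entries of the $n$ matrices $$A_{n-1}A_{n-2}\cdots A_0-\pi,\quad A_{n-2}\cdots A_0A_{n-1}-\pi,\quad\dots,\quad A_0A_{n-1}\cdots A_1-\pi .$$ -/

import Mathlib

open CategoryTheory AlgebraicGeometry Opposite TopologicalSpace

universe u

noncomputable section

namespace LocalModel

/-! ### The lattice chain -/

section Lattices

variable {O : Type u} [CommRing O] [IsDomain O]

/-- The successor of `i` in the cyclic order of `0, …, m - 1`. -/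
def next {m : ℕ} (i : Fin m) : Fin m :=
  ⟨(i.1 + 1) % m, Nat.mod_lt _ i.pos⟩

/-- The vector `e^i_j` of `K^n`, where `K = Frac O`. Here `j` runs through `0, …, n - 1`, so that
`e^i_j = π⁻¹ e_j` for `j < i` and `e^i_j = e_j` for `i ≤ j`. -/
def latticeVec (π : O) {n : ℕ} (i j : Fin n) : Fin n → FractionRing O :=
  Pi.single j (if j < i then (algebraMap O (FractionRing O) π)⁻¹ else 1)

/-- The lattice `Λ_i` in `K^n`, the `O`-span of `e^i_0, …, e^i_{n-1}`. -/
def lattice (π : O) {n : ℕ} (i : Fin n) : Submodule O (Fin n → FractionRing O) :=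
  Submodule.span O (Set.range (latticeVec π i))

theorem linearIndependent_latticeVec {π : O} (hπ : π ≠ 0) {n : ℕ} (i : Fin n) :
    LinearIndependent O (latticeVec π i) := by
  have hπ' : algebraMap O (FractionRing O) π ≠ 0 := by simpa using hπ
  rw [Fintype.linearIndependent_iff]
  intro g hg j
  have h := congrFun hg j
  rw [Finset.sum_apply, Finset.sum_eq_single j] at h
  · have hne : (if j < i then (algebraMap O (FractionRing O) π)⁻¹ else 1) ≠ 0 := by
      split_ifs
      · exact inv_ne_zero hπ'
      · exact one_ne_zero
    simp only [latticeVec, Pi.smul_apply, Pi.single_eq_same, Pi.zero_apply,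
      Algebra.smul_def, mul_eq_zero] at h
    rcases h with h | h
    · simpa using h
    · exact absurd h hne
  · intro b _ hb
    simp [latticeVec, Pi.single_eq_of_ne hb.symm]
  · intro hj
    exact absurd (Finset.mem_univ j) hj

/-- The basis `e^i_0, …, e^i_{n-1}` of the free `O`-module `Λ_i`. -/
def latticeBasis {π : O} (hπ : π ≠ 0) {n : ℕ} (i : Fin n) :
    Module.Basis (Fin n) O (lattice π i) :=
  Module.Basis.span (linearIndependent_latticeVec hπ i)

theorem coe_latticeBasis {π : O} (hπ : π ≠ 0) {n : ℕ} (i j : Fin n) :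
    ((latticeBasis hπ i j : lattice π i) : Fin n → FractionRing O) = latticeVec π i j :=
  congrArg Subtype.val (Module.Basis.span_apply (linearIndependent_latticeVec hπ i) j)

/-- The scalar by which the `i`-th transition map acts on `K^n`: the maps `Λ_i → Λ_{i+1}`,
`i < n - 1`, are the inclusions, and `Λ_{n-1} → Λ_0` is multiplication by `π`. -/
def transitionScalar (π : O) {n : ℕ} (i : Fin n) : O :=
  if i.1 + 1 < n then 1 else π

theorem transitionScalar_smul_latticeVec {π : O} (hπ : π ≠ 0) {n : ℕ} (i j : Fin n) :
    transitionScalar π i • latticeVec π i j =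
      (if j = i then π else 1) • latticeVec π (next i) j := by
  have hπ' : algebraMap O (FractionRing O) π ≠ 0 := by simpa using hπ
  have hj := j.2
  have hi := i.2
  unfold transitionScalar latticeVec
  rw [← Pi.single_smul, ← Pi.single_smul]
  congr 1
  by_cases h : i.1 + 1 < n
  · have hn : (next i).1 = i.1 + 1 := Nat.mod_eq_of_lt h
    rw [if_pos h, one_smul]
    by_cases hji : j = i
    · subst hji
      have h2 : j < next j := by rw [Fin.lt_def, hn]; omega
      simp [h2, Algebra.smul_def, hπ']
    · have hne : j.1 ≠ i.1 := fun e => hji (Fin.ext e)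
      have h2 : j < next i ↔ j < i := by rw [Fin.lt_def, Fin.lt_def, hn]; omega
      simp [hji, h2]
  · have hn : (next i).1 = 0 := by
      have : i.1 + 1 = n := by omega
      simp [next, this]
    rw [if_neg h]
    have h2 : ¬ j < next i := by rw [Fin.lt_def, hn]; omega
    by_cases hji : j = i
    · subst hji
      simp [h2]
    · have hne : j.1 ≠ i.1 := fun e => hji (Fin.ext e)
      have h3 : j < i := by rw [Fin.lt_def]; omega
      simp [hji, h2, h3, Algebra.smul_def, hπ']

theorem transitionScalar_smul_mem {π : O} (hπ : π ≠ 0) {n : ℕ} (i : Fin n)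
    (v : Fin n → FractionRing O) (hv : v ∈ lattice π i) :
    transitionScalar π i • v ∈ lattice π (next i) := by
  induction hv using Submodule.span_induction with
  | mem x hx =>
    obtain ⟨j, rfl⟩ := hx
    rw [transitionScalar_smul_latticeVec hπ]
    exact Submodule.smul_mem _ _ (Submodule.subset_span ⟨j, rfl⟩)
  | zero => simp
  | add x y _ _ hx hy => rw [smul_add]; exact Submodule.add_mem _ hx hy
  | smul a x _ hx => rw [smul_comm]; exact Submodule.smul_mem _ _ hx

/-- The transition map `φ_i : Λ_i → Λ_{i+1}` of the lattice chain
`Λ_0 ⊆ Λ_1 ⊆ ⋯ ⊆ Λ_{n-1} → Λ_0`, where the last map is multiplication by `π`. -/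
def transition {π : O} (hπ : π ≠ 0) {n : ℕ} (i : Fin n) :
    lattice π i →ₗ[O] lattice π (next i) :=
  (LinearMap.lsmul O (Fin n → FractionRing O) (transitionScalar π i)).restrict
    (transitionScalar_smul_mem hπ i)

/-- The matrix of `φ_i` with respect to the bases `e^i` and `e^{i+1}`. -/
def transitionMatrix {π : O} (hπ : π ≠ 0) {n : ℕ} (i : Fin n) : Matrix (Fin n) (Fin n) O :=
  LinearMap.toMatrix (latticeBasis hπ i) (latticeBasis hπ (next i)) (transition hπ i)

theorem transitionMatrix_eq {π : O} (hπ : π ≠ 0) {n : ℕ} (i : Fin n) :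
    transitionMatrix hπ i = Matrix.diagonal (fun j => if j = i then π else 1) := by
  ext a b
  have h : transition hπ i (latticeBasis hπ i b) =
      (if b = i then π else 1) • latticeBasis hπ (next i) b := by
    apply Subtype.ext
    change transitionScalar π i • ((latticeBasis hπ i b : lattice π i) : Fin n → FractionRing O) =
      (if b = i then π else 1) • ((latticeBasis hπ (next i) b : lattice π (next i)) :
        Fin n → FractionRing O)
    rw [coe_latticeBasis, coe_latticeBasis, transitionScalar_smul_latticeVec hπ]
  rw [transitionMatrix, LinearMap.toMatrix_apply, h, map_smul, Module.Basis.repr_self,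
    Matrix.diagonal_apply]
  rw [Finsupp.smul_apply, Finsupp.single_apply]
  by_cases hab : a = b
  · subst hab; simp
  · rw [if_neg hab, if_neg (Ne.symm hab), smul_zero]

end Lattices

/-! ### Submodules of `O_S^n` that are locally direct summands -/

section Subbundles

/-- The map `Γ(S, U)^n → Γ(T, V)^n` on vectors of functions induced by `f : T ⟶ S`,
for `f(V) ⊆ U`. -/
def pullVec {S T : Scheme.{u}} (f : T ⟶ S) {n : ℕ} (U : S.Opens) (V : T.Opens) (e : V ≤ f ⁻¹ᵁ U)
    (s : Fin n → Γ(S, U)) : Fin n → Γ(T, V) :=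
  fun j => (f.appLE U V e).hom (s j)

/-- Restriction of vectors of functions to a smaller open subset. -/
def resVec {S : Scheme.{u}} {n : ℕ} {U V : S.Opens} (h : V ≤ U) (s : Fin n → Γ(S, U)) :
    Fin n → Γ(S, V) :=
  fun j => (S.presheaf.map (homOfLE h).op).hom (s j)

/-- Restriction of matrices of functions to a smaller open subset. -/
def resMat {S : Scheme.{u}} {n r : ℕ} {U V : S.Opens} (h : V ≤ U)
    (B : Matrix (Fin n) (Fin r) Γ(S, U)) : Matrix (Fin n) (Fin r) Γ(S, V) :=
  B.map (S.presheaf.map (homOfLE h).op).hom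

/-- An `O_S`-submodule (subsheaf of `O_S`-modules) `F` of `O_S^n` which is locally free of rank `r`
and which is, Zariski-locally on `S`, a direct summand of `O_S^n`. The last condition says that `S`
is covered by open subsets `U` for which there is an `O_U`-linear map `B : O_U^r → O_U^n` with image
`F|_U` and with an `O_U`-linear left inverse `C : O_U^n → O_U^r`. -/
@[ext]
structure Subbundle (S : Scheme.{u}) (n r : ℕ) where
  sections : ∀ U : S.Opens, Submodule Γ(S, U) (Fin n → Γ(S, U))
  res_mem : ∀ {U V : S.Opens} (h : V ≤ U) (s : Fin n → Γ(S, U)),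
    s ∈ sections U → resVec h s ∈ sections V
  glue : ∀ (U : S.Opens) (s : Fin n → Γ(S, U)),
    (∀ x ∈ U, ∃ (V : S.Opens) (h : V ≤ U), x ∈ V ∧ resVec h s ∈ sections V) → s ∈ sections U
  locally_split : ∀ x : S, ∃ U : S.Opens, x ∈ U ∧
    ∃ (B : Matrix (Fin n) (Fin r) Γ(S, U)) (C : Matrix (Fin r) (Fin n) Γ(S, U)),
      C * B = 1 ∧ ∀ (V : S.Opens) (h : V ≤ U), sections V = LinearMap.range (resMat h B).mulVecLin

variable {S T T' : Scheme.{u}} {n r : ℕ}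

theorem resVec_resVec {U V W : S.Opens} (h : V ≤ U) (h' : W ≤ V) (s : Fin n → Γ(S, U)) :
    resVec h' (resVec h s) = resVec (h'.trans h) s := by
  funext j
  simp only [resVec]
  rw [← CommRingCat.comp_apply, ← Functor.map_comp]
  rfl

theorem resVec_self {U : S.Opens} (h : U ≤ U) (s : Fin n → Γ(S, U)) : resVec h s = s := by
  funext j
  simp only [resVec]
  have : (homOfLE h).op = 𝟙 (op U) := rfl
  rw [this, S.presheaf.map_id]
  rfl

theorem resVec_add {U V : S.Opens} (h : V ≤ U) (s t : Fin n → Γ(S, U)) :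
    resVec h (s + t) = resVec h s + resVec h t := by
  funext j
  simp [resVec]

theorem resVec_zero {U V : S.Opens} (h : V ≤ U) :
    resVec h (0 : Fin n → Γ(S, U)) = 0 := by
  funext j
  simp [resVec]

theorem resVec_smul {U V : S.Opens} (h : V ≤ U) (a : Γ(S, U)) (s : Fin n → Γ(S, U)) :
    resVec h (a • s) = (S.presheaf.map (homOfLE h).op).hom a • resVec h s := by
  funext j
  simp [resVec]

theorem resVec_mulVec {U V : S.Opens} (h : V ≤ U) (B : Matrix (Fin n) (Fin r) Γ(S, U))
    (c : Fin r → Γ(S, U)) :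
    resVec h (B.mulVec c) = (resMat h B).mulVec (resVec h c) := by
  funext j
  simp [resVec, resMat, Matrix.mulVec, dotProduct, map_sum]

theorem resMat_resMat {U V W : S.Opens} (h : V ≤ U) (h' : W ≤ V)
    (B : Matrix (Fin n) (Fin r) Γ(S, U)) :
    resMat h' (resMat h B) = resMat (h'.trans h) B := by
  ext i j
  simp only [resMat, Matrix.map_apply]
  rw [← CommRingCat.comp_apply, ← Functor.map_comp]
  rfl

theorem eq_of_locally_eq {U : S.Opens} (s t : Fin n → Γ(S, U))
    (H : ∀ x ∈ U, ∃ (V : S.Opens) (h : V ≤ U), x ∈ V ∧ resVec h s = resVec h t) : s = t := by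
  funext j
  choose V h hx hst using H
  refine TopCat.Sheaf.eq_of_locally_eq' S.sheaf (fun x : U => V x.1 x.2) U
    (fun x => homOfLE (h x.1 x.2)) ?_ _ _ ?_
  · intro x hxU
    exact Opens.mem_iSup.mpr ⟨⟨x, hxU⟩, hx x hxU⟩
  · intro x
    exact congrFun (hst x.1 x.2) j

theorem resVec_pullVec (f : T ⟶ S) {U : S.Opens} {V W : T.Opens} (e : V ≤ f ⁻¹ᵁ U) (h : W ≤ V)
    (s : Fin n → Γ(S, U)) :
    resVec h (pullVec f U V e s) = pullVec f U W (h.trans e) s := by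
  funext j
  simp only [resVec, pullVec]
  rw [← CommRingCat.comp_apply, Scheme.Hom.appLE_map]

theorem pullVec_resVec (f : T ⟶ S) {U U' : S.Opens} {V : T.Opens} (h : U' ≤ U)
    (e : V ≤ f ⁻¹ᵁ U') (s : Fin n → Γ(S, U)) :
    pullVec f U' V e (resVec h s) =
      pullVec f U V (e.trans (fun _ hx => h hx)) s := by
  funext j
  simp only [resVec, pullVec]
  rw [← CommRingCat.comp_apply, Scheme.Hom.map_appLE]

theorem pullVec_pullVec (f : T ⟶ S) (g : T' ⟶ T) {U : S.Opens} {V : T.Opens} {W : T'.Opens}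
    (e : V ≤ f ⁻¹ᵁ U) (e' : W ≤ g ⁻¹ᵁ V) (s : Fin n → Γ(S, U)) :
    pullVec g V W e' (pullVec f U V e s) =
      pullVec (g ≫ f) U W (e'.trans (fun _ hx => e hx)) s := by
  funext j
  simp only [pullVec]
  rw [← CommRingCat.comp_apply, Scheme.Hom.appLE_comp_appLE]

theorem pullVec_id {U V : S.Opens} (e : V ≤ (𝟙 S : S ⟶ S) ⁻¹ᵁ U) (s : Fin n → Γ(S, U)) :
    pullVec (𝟙 S) U V e s = resVec (show V ≤ U from e) s := by
  funext j
  simp only [resVec, pullVec, Scheme.Hom.appLE, Scheme.Hom.id_app]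
  rfl

theorem pullVec_mulVec (f : T ⟶ S) {U : S.Opens} {V : T.Opens} (e : V ≤ f ⁻¹ᵁ U)
    (B : Matrix (Fin n) (Fin r) Γ(S, U)) (c : Fin r → Γ(S, U)) :
    pullVec f U V e (B.mulVec c) =
      (B.map (f.appLE U V e).hom).mulVec (pullVec f U V e c) := by
  funext j
  simp [pullVec, Matrix.mulVec, dotProduct, map_sum]

theorem resMat_map_appLE (f : T ⟶ S) {U : S.Opens} {V W : T.Opens} (e : V ≤ f ⁻¹ᵁ U) (h : W ≤ V)
    (B : Matrix (Fin n) (Fin r) Γ(S, U)) :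
    resMat h (B.map (f.appLE U V e).hom) = B.map (f.appLE U W (h.trans e)).hom := by
  ext i j
  simp only [resMat, Matrix.map_apply]
  rw [← CommRingCat.comp_apply, Scheme.Hom.appLE_map]

namespace Subbundle

/-- The submodule of `Γ(T, V)^n` spanned by the pulled back sections of `F` over `U`. -/
def pullSpan (F : Subbundle S n r) (f : T ⟶ S) (U : S.Opens) (V : T.Opens) (e : V ≤ f ⁻¹ᵁ U) :
    Submodule Γ(T, V) (Fin n → Γ(T, V)) :=
  Submodule.span Γ(T, V) (pullVec f U V e '' (F.sections U : Set (Fin n → Γ(S, U))))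

theorem resVec_mem_pullSpan (F : Subbundle S n r) (f : T ⟶ S) {U U' : S.Opens} {V V' : T.Opens}
    (e : V ≤ f ⁻¹ᵁ U) (e' : V' ≤ f ⁻¹ᵁ U') (hU : U' ≤ U) (hV : V' ≤ V)
    (s : Fin n → Γ(T, V)) (hs : s ∈ F.pullSpan f U V e) :
    resVec hV s ∈ F.pullSpan f U' V' e' := by
  induction hs using Submodule.span_induction with
  | mem x hx =>
    obtain ⟨t, ht, rfl⟩ := hx
    rw [resVec_pullVec]
    refine Submodule.subset_span ⟨resVec hU t, F.res_mem hU t ht, ?_⟩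
    rw [pullVec_resVec]
  | zero => rw [resVec_zero]; exact Submodule.zero_mem _
  | add x y _ _ hx hy => rw [resVec_add]; exact Submodule.add_mem _ hx hy
  | smul a x _ hx => rw [resVec_smul]; exact Submodule.smul_mem _ _ hx

/-- The sections over `W` of the subsheaf of `O_T`-modules of `O_T^n` which is generated by the
pulled back sections of `F`, that is, of the image of `f^* F → f^* O_S^n = O_T^n`. -/
def pullSections (F : Subbundle S n r) (f : T ⟶ S) (W : T.Opens) :
    Submodule Γ(T, W) (Fin n → Γ(T, W)) where
  carrier := {s | ∀ x ∈ W, ∃ (V : T.Opens) (h : V ≤ W), x ∈ V ∧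
    ∃ (U : S.Opens) (e : V ≤ f ⁻¹ᵁ U), resVec h s ∈ F.pullSpan f U V e}
  zero_mem' := by
    intro x hx
    refine ⟨W, le_rfl, hx, ⊤, le_top, ?_⟩
    rw [resVec_zero]
    exact Submodule.zero_mem _
  add_mem' := by
    intro s t hs ht x hx
    obtain ⟨V, h, hxV, U, e, hsV⟩ := hs x hx
    obtain ⟨V', h', hxV', U', e', htV⟩ := ht x hx
    have e'' : V ⊓ V' ≤ f ⁻¹ᵁ (U ⊓ U') := fun y hy => ⟨e hy.1, e' hy.2⟩
    refine ⟨V ⊓ V', inf_le_left.trans h, ⟨hxV, hxV'⟩, U ⊓ U', e'', ?_⟩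
    rw [resVec_add]
    refine Submodule.add_mem _ ?_ ?_
    · have := F.resVec_mem_pullSpan f e e'' inf_le_left inf_le_left _ hsV
      rwa [resVec_resVec] at this
    · have := F.resVec_mem_pullSpan f e' e'' inf_le_right inf_le_right _ htV
      rwa [resVec_resVec] at this
  smul_mem' := by
    intro a s hs x hx
    obtain ⟨V, h, hxV, U, e, hsV⟩ := hs x hx
    refine ⟨V, h, hxV, U, e, ?_⟩
    rw [resVec_smul]
    exact Submodule.smul_mem _ _ hsV

theorem pullSections_res (F : Subbundle S n r) (f : T ⟶ S) {W W' : T.Opens} (h : W' ≤ W)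
    (s : Fin n → Γ(T, W)) (hs : s ∈ F.pullSections f W) : resVec h s ∈ F.pullSections f W' := by
  intro x hx
  obtain ⟨V, hV, hxV, U, e, hsV⟩ := hs x (h hx)
  refine ⟨V ⊓ W', inf_le_right, ⟨hxV, hx⟩, U, inf_le_left.trans e, ?_⟩
  have := F.resVec_mem_pullSpan f e (inf_le_left.trans e : V ⊓ W' ≤ _) le_rfl inf_le_left _ hsV
  rw [resVec_resVec] at this ⊢
  exact this

theorem pullSections_glue (F : Subbundle S n r) (f : T ⟶ S) (W : T.Opens)
    (s : Fin n → Γ(T, W))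
    (H : ∀ x ∈ W, ∃ (V : T.Opens) (h : V ≤ W), x ∈ V ∧ resVec h s ∈ F.pullSections f V) :
    s ∈ F.pullSections f W := by
  intro x hx
  obtain ⟨V, h, hxV, hs⟩ := H x hx
  obtain ⟨V', h', hxV', U, e, hs'⟩ := hs x hxV
  refine ⟨V', h'.trans h, hxV', U, e, ?_⟩
  rwa [resVec_resVec] at hs'

theorem pullVec_mem_pullSections (F : Subbundle S n r) (f : T ⟶ S) {U : S.Opens} {V : T.Opens}
    (e : V ≤ f ⁻¹ᵁ U) (s : Fin n → Γ(S, U)) (hs : s ∈ F.sections U) :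
    pullVec f U V e s ∈ F.pullSections f V := by
  intro x hx
  refine ⟨V, le_rfl, hx, U, e, ?_⟩
  rw [resVec_self]
  exact Submodule.subset_span ⟨s, hs, rfl⟩

/-- To bound the pullback by a subsheaf of modules, it is enough to bound the pulled back
sections. -/
theorem pullSections_le (F : Subbundle S n r) (f : T ⟶ S)
    (G : ∀ W : T.Opens, Submodule Γ(T, W) (Fin n → Γ(T, W)))
    (hglue : ∀ (W : T.Opens) (s : Fin n → Γ(T, W)),
      (∀ x ∈ W, ∃ (V : T.Opens) (h : V ≤ W), x ∈ V ∧ resVec h s ∈ G V) → s ∈ G W)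
    (H : ∀ (U : S.Opens) (V : T.Opens) (e : V ≤ f ⁻¹ᵁ U) (s : Fin n → Γ(S, U)),
      s ∈ F.sections U → pullVec f U V e s ∈ G V) (W : T.Opens) :
    F.pullSections f W ≤ G W := by
  intro s hs
  refine hglue W s fun x hx => ?_
  obtain ⟨V, h, hxV, U, e, hsV⟩ := hs x hx
  refine ⟨V, h, hxV, ?_⟩
  have : F.pullSpan f U V e ≤ G V := by
    refine Submodule.span_le.mpr ?_
    rintro _ ⟨t, ht, rfl⟩
    exact H U V e t ht
  exact this hsV

/-- The pullback `f^* F ⊆ f^* O_S^n = O_T^n` of `F ⊆ O_S^n` along `f : T ⟶ S`. -/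
def pullback (F : Subbundle S n r) (f : T ⟶ S) : Subbundle T n r where
  sections := F.pullSections f
  res_mem := F.pullSections_res f
  glue := F.pullSections_glue f
  locally_split := by
    intro y
    obtain ⟨U, hyU, B, C, hCB, hF⟩ := F.locally_split (f y)
    refine ⟨f ⁻¹ᵁ U, hyU, B.map (f.appLE U _ le_rfl).hom, C.map (f.appLE U _ le_rfl).hom, ?_, ?_⟩
    · rw [← Matrix.map_mul, hCB, Matrix.map_one _ (map_zero _) (map_one _)]
    intro V hV
    apply le_antisymm
    · intro s hs
      refine ⟨(resMat hV (C.map (f.appLE U _ le_rfl).hom)).mulVec s, ?_⟩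
      rw [Matrix.mulVecLin_apply]
      refine eq_of_locally_eq _ _ fun x hx => ?_
      obtain ⟨V', h, hxV, U', e, hsV⟩ := hs x hx
      have e' : V' ≤ f ⁻¹ᵁ (U' ⊓ U) := fun z hz => ⟨e hz, hV (h hz)⟩
      refine ⟨V', h, hxV, ?_⟩
      have h1 := F.resVec_mem_pullSpan f e e' inf_le_left le_rfl _ hsV
      rw [resVec_self] at h1
      rw [resVec_mulVec, resVec_mulVec, resMat_resMat, resMat_resMat, resMat_map_appLE,
        resMat_map_appLE]
      generalize resVec h s = t at h1
      induction h1 using Submodule.span_induction with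
      | mem t ht =>
        obtain ⟨w, hw, rfl⟩ := ht
        rw [SetLike.mem_coe, hF _ inf_le_right] at hw
        obtain ⟨c, rfl⟩ := hw
        rw [Matrix.mulVecLin_apply, pullVec_mulVec]
        have hB : (resMat inf_le_right B : Matrix _ _ Γ(S, U' ⊓ U)).map
            (f.appLE (U' ⊓ U) V' e').hom = B.map (f.appLE U V' (h.trans hV)).hom := by
          ext i j
          simp only [resMat, Matrix.map_apply]
          rw [← CommRingCat.comp_apply, Scheme.Hom.map_appLE]
        have hCB' : C.map (f.appLE U V' (h.trans hV)).hom * B.map (f.appLE U V' (h.trans hV)).hom = 1 := by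
          rw [← Matrix.map_mul, hCB, Matrix.map_one _ (map_zero _) (map_one _)]
        rw [hB]
        congr 1
        rw [Matrix.mulVec_mulVec, hCB', Matrix.one_mulVec]
      | zero => simp
      | add a b _ _ ha hb => rw [Matrix.mulVec_add, Matrix.mulVec_add, ha, hb]
      | smul a b _ hb => rw [Matrix.mulVec_smul, Matrix.mulVec_smul, hb]
    · rintro _ ⟨c, rfl⟩
      rw [resMat_map_appLE, Matrix.mulVecLin_apply, Matrix.mulVec_eq_sum]
      refine Submodule.sum_mem _ fun k _ => ?_
      rw [op_smul_eq_smul]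
      refine Submodule.smul_mem _ _ ?_
      have : (B.map (f.appLE U V (hV.trans le_rfl)).hom).transpose k =
          pullVec f U V hV (B.mulVec (Pi.single k 1)) := by
        funext j
        simp [pullVec, Matrix.transpose_apply]
      rw [this]
      refine F.pullVec_mem_pullSections f hV _ ?_
      rw [hF U le_rfl]
      refine ⟨Pi.single k 1, ?_⟩
      rw [Matrix.mulVecLin_apply]
      congr 1
      ext i j
      simp only [resMat, Matrix.map_apply]
      have : (homOfLE (le_refl U)).op = 𝟙 (op U) := rfl
      rw [this, S.presheaf.map_id]
      rfl

theorem pullback_id (F : Subbundle S n r) : F.pullback (𝟙 S) = F := by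
  ext1
  funext W
  apply le_antisymm
  · refine F.pullSections_le (𝟙 S) F.sections F.glue ?_ W
    intro U V e s hs
    rw [pullVec_id]
    exact F.res_mem _ s hs
  · intro s hs
    have := F.pullVec_mem_pullSections (𝟙 S) (U := W) (V := W) le_rfl s hs
    have h2 : pullVec (𝟙 S) W W le_rfl s = s := by
      funext j
      simp only [pullVec, Scheme.Hom.appLE, Scheme.Hom.id_app]
      have : (homOfLE (le_refl W)).op = 𝟙 (op W) := rfl
      change (S.presheaf.map (𝟙 (op W))).hom (s j) = s j
      rw [S.presheaf.map_id]
      rfl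
    rw [← h2]
    exact this

theorem pullback_comp (F : Subbundle S n r) (f : T ⟶ S) (g : T' ⟶ T) :
    F.pullback (g ≫ f) = (F.pullback f).pullback g := by
  ext1
  funext W
  apply le_antisymm
  · refine F.pullSections_le (g ≫ f) _ ((F.pullback f).pullSections_glue g) ?_ W
    intro U V e s hs
    have h1 : V ≤ g ⁻¹ᵁ (f ⁻¹ᵁ U) := e
    rw [show pullVec (g ≫ f) U V e s = pullVec g (f ⁻¹ᵁ U) V h1 (pullVec f U (f ⁻¹ᵁ U) le_rfl s) from
      (pullVec_pullVec f g le_rfl h1 s).symm]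
    exact (F.pullback f).pullVec_mem_pullSections g h1 _
      (F.pullVec_mem_pullSections f le_rfl s hs)
  · refine (F.pullback f).pullSections_le g _ (F.pullSections_glue (g ≫ f)) ?_ W
    intro U V e s hs
    refine F.pullSections_glue (g ≫ f) V _ fun x hx => ?_
    obtain ⟨U', h, hxU, U'', e', hs'⟩ := hs (g x) (e hx)
    have e1 : V ⊓ g ⁻¹ᵁ U' ≤ g ⁻¹ᵁ U' := inf_le_right
    refine ⟨V ⊓ g ⁻¹ᵁ U', inf_le_left, ⟨hx, hxU⟩, ?_⟩
    rw [resVec_pullVec]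
    have h2 : pullVec g U (V ⊓ g ⁻¹ᵁ U') (inf_le_left.trans e) s =
        pullVec g U' (V ⊓ g ⁻¹ᵁ U') e1 (resVec h s) := by
      rw [pullVec_resVec]
    rw [h2]
    generalize resVec h s = t at hs'
    induction hs' using Submodule.span_induction with
    | mem t ht =>
      obtain ⟨w, hw, rfl⟩ := ht
      rw [pullVec_pullVec]
      exact F.pullVec_mem_pullSections (g ≫ f) _ w hw
    | zero =>
      have : pullVec g U' (V ⊓ g ⁻¹ᵁ U') e1 (0 : Fin n → Γ(T, U')) = 0 := by
        funext j; simp [pullVec]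
      rw [this]
      exact Submodule.zero_mem _
    | add a b _ _ ha hb =>
      have : pullVec g U' (V ⊓ g ⁻¹ᵁ U') e1 (a + b) =
          pullVec g U' (V ⊓ g ⁻¹ᵁ U') e1 a + pullVec g U' (V ⊓ g ⁻¹ᵁ U') e1 b := by
        funext j; simp [pullVec]
      rw [this]
      exact Submodule.add_mem _ ha hb
    | smul a b _ hb =>
      have : pullVec g U' (V ⊓ g ⁻¹ᵁ U') e1 (a • b) =
          (g.appLE U' (V ⊓ g ⁻¹ᵁ U') e1).hom a • pullVec g U' (V ⊓ g ⁻¹ᵁ U') e1 b := by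
        funext j; simp [pullVec]
      rw [this]
      exact Submodule.smul_mem _ _ hb

/-- The open subset of `S` over which the quotient `O_S^n / F` is generated by the (images of the)
standard basis vectors `e_j`, `j ∈ J`. -/
def generatedLocus (F : Subbundle S n r) (J : Set (Fin n)) : S.Opens where
  carrier := {x | ∃ U : S.Opens, x ∈ U ∧ F.sections U ⊔
    Submodule.span Γ(S, U) ((fun j => (Pi.single j 1 : Fin n → Γ(S, U))) '' J) = ⊤}
  is_open' := by
    rw [isOpen_iff_forall_mem_open]
    rintro x ⟨U, hxU, hU⟩
    exact ⟨U, fun y hy => ⟨U, hy, hU⟩, U.isOpen, hxU⟩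

end Subbundle

end Subbundles

/-! ### The standard local model -/

section Functor

variable {O : Type u} [CommRing O]

/-- The structure map `O → Γ(S, U)` of an `O`-scheme `S`. -/
def structMap (S : Over (Spec (CommRingCat.of O))) (U : S.left.Opens) : O →+* Γ(S.left, U) :=
  ((Scheme.ΓSpecIso (CommRingCat.of O)).inv ≫ S.hom.appLE ⊤ U (by simp)).hom

theorem appLE_comp_eq {X Y Z : Scheme.{u}} (g : X ⟶ Y) (p : Y ⟶ Z) (q : X ⟶ Z) (w : g ≫ p = q)
    (U : Y.Opens) (V : X.Opens) (e : V ≤ g ⁻¹ᵁ U) (e₁ : U ≤ p ⁻¹ᵁ ⊤) (e₂ : V ≤ q ⁻¹ᵁ ⊤) :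
    p.appLE ⊤ U e₁ ≫ g.appLE U V e = q.appLE ⊤ V e₂ := by
  subst w
  exact Scheme.Hom.appLE_comp_appLE _ _ _ _ _ _ _

theorem appLE_structMap {S T : Over (Spec (CommRingCat.of O))} (f : T ⟶ S) (U : S.left.Opens)
    (V : T.left.Opens) (e : V ≤ f.left ⁻¹ᵁ U) (a : O) :
    (f.left.appLE U V e).hom (structMap S U a) = structMap T V a :=
  congrArg (fun φ => φ.hom ((Scheme.ΓSpecIso (CommRingCat.of O)).inv.hom a))
    (appLE_comp_eq f.left S.hom T.hom (Over.w f) U V e (by simp) (by simp))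

variable {m n : ℕ}

/-- An `S`-valued point of the scheme of compatible subspaces attached to the cyclic chain
`O^n → O^n → ⋯ → O^n` of `m` maps given by the matrices `φ_i`: submodules `F_i` of
`Λ_{i,S} = O_S^n`, locally free of rank `r` and locally direct summands, such that `φ_i` maps `F_i`
into `F_{i+1}`, indices being read cyclically. -/
@[ext]
structure CompatibleFamily (φ : Fin m → Matrix (Fin n) (Fin n) O) (r : ℕ)
    (S : Over (Spec (CommRingCat.of O))) where
  sub : Fin m → Subbundle S.left n r
  compat : ∀ (i : Fin m) (U : S.left.Opens) (s : Fin n → Γ(S.left, U)),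
    s ∈ (sub i).sections U → ((φ i).map (structMap S U)).mulVec s ∈ (sub (next i)).sections U

/-- Base change of a compatible family along a morphism of `O`-schemes. -/
def CompatibleFamily.pullback {φ : Fin m → Matrix (Fin n) (Fin n) O} {r : ℕ}
    {S T : Over (Spec (CommRingCat.of O))} (F : CompatibleFamily φ r S) (f : T ⟶ S) :
    CompatibleFamily φ r T where
  sub i := (F.sub i).pullback f.left
  compat i W s hs := by
    have key := (F.sub i).pullSections_le f.left
      (fun W => (((F.sub (next i)).pullback f.left).sections W).comap
        ((φ i).map (structMap T W)).mulVecLin) ?_ ?_ W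
    · exact key hs
    · intro W s H
      refine ((F.sub (next i)).pullback f.left).glue W _ fun x hx => ?_
      obtain ⟨V, h, hxV, hV⟩ := H x hx
      refine ⟨V, h, hxV, ?_⟩
      rw [Matrix.mulVecLin_apply, resVec_mulVec]
      have : resMat h ((φ i).map (structMap T W)) = (φ i).map (structMap T V) := by
        ext a b
        simp only [resMat, Matrix.map_apply]
        have h2 := appLE_structMap (𝟙 T) W V h (φ i a b)
        rw [← h2]
        simp only [Over.id_left, Scheme.Hom.appLE, Scheme.Hom.id_app]
        rfl
      rw [this]
      exact hV
    · intro U V e s hs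
      have h1 := ((F.sub (next i)).pullVec_mem_pullSections f.left e _ (F.compat i U s hs))
      rw [pullVec_mulVec] at h1
      have : ((φ i).map (structMap S U)).map (f.left.appLE U V e).hom =
          (φ i).map (structMap T V) := by
        ext a b
        simp only [Matrix.map_apply]
        exact appLE_structMap f U V e (φ i a b)
      rw [this] at h1
      exact h1

/-- The functor of compatible subspaces on the category of `O`-schemes. -/
def compatibleSubspaces (φ : Fin m → Matrix (Fin n) (Fin n) O) (r : ℕ) :
    (Over (Spec (CommRingCat.of O)))ᵒᵖ ⥤ Type u where
  obj S := CompatibleFamily φ r S.unop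
  map f := ↾(fun F => F.pullback f.unop)
  map_id S := by
    refine ConcreteCategory.hom_ext _ _ fun F => CompatibleFamily.ext ?_
    funext i
    exact (F.sub i).pullback_id
  map_comp f g := by
    refine ConcreteCategory.hom_ext _ _ fun F => CompatibleFamily.ext ?_
    funext i
    exact (F.sub i).pullback_comp f.unop.left g.unop.left

end Functor

section Model

variable {O : Type u} [CommRing O] [IsDomain O]

/-- The functor on `O`-schemes that defines the standard local model (for the complete lattice
chain `Λ_0 → Λ_1 → ⋯ → Λ_{n-1} → Λ_0` and the minuscule cocharacter `(1^r, 0^{n-r})`).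
The module `Λ_{i,S} = Λ_i ⊗ O_S` is identified with `O_S^n` by means of the basis `e^i`. -/
def localModelFunctor {π : O} (hπ : π ≠ 0) (n r : ℕ) :
    (Over (Spec (CommRingCat.of O)))ᵒᵖ ⥤ Type u :=
  compatibleSubspaces (fun i : Fin n => transitionMatrix hπ i) r

/-- The family `(F_i)_i` over `S` underlying an element of `localModelFunctor` on `S`. -/
def family {π : O} {hπ : π ≠ 0} {n r : ℕ} {S : Over (Spec (CommRingCat.of O))}
    (F : (localModelFunctor hπ n r).obj (op S)) :
    CompatibleFamily (fun i : Fin n => transitionMatrix hπ i) r S := F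

/-- The vertices `ω_i = (1^i, 0^{n-i})` of the base alcove. -/
def omega {n : ℕ} (i j : Fin n) : ℕ := if j < i then 1 else 0

/-- The vertices of the alcove
`τ = ((1^r, 0^{n-r}), (1^{r+1}, 0^{n-r-1}), …, (2^{r-1}, 1^{n-r+1}))`, that is,
`τ_i = (1^{r+i}, 0^{n-r-i})` if `r + i ≤ n` and `τ_i = (2^{r+i-n}, 1^{2n-r-i})` otherwise. -/
def tau (r : ℕ) {n : ℕ} (i j : Fin n) : ℕ :=
  (if j.1 < r + i.1 then 1 else 0) + (if j.1 + n < r + i.1 then 1 else 0)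

/-- The open subset `U_τ` for a family `(F_i)_i` over `S`: the locus where, for every `i`, the
quotient `Λ_{i,S} / F_i` is generated by those `e^i_j` with `ω_i(j) = τ_i(j)`. -/
def tauLocus {n r : ℕ} {φ : Fin n → Matrix (Fin n) (Fin n) O}
    {S : Over (Spec (CommRingCat.of O))} (F : CompatibleFamily φ r S) : S.left.Opens where
  carrier := {x | ∀ i : Fin n, x ∈ (F.sub i).generatedLocus {j | omega i j = tau r i j}}
  is_open' := by
    have : {x | ∀ i : Fin n, x ∈ (F.sub i).generatedLocus {j | omega i j = tau r i j}} =
        ⋂ i : Fin n, ((F.sub i).generatedLocus {j | omega i j = tau r i j} : Set S.left) := by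
      ext x
      simp
    rw [this]
    exact isOpen_iInter_of_finite fun i => ((F.sub i).generatedLocus _).isOpen

/-- The open subset `U_τ` of the standard local model, for any `O`-scheme `M` representing the
functor `localModelFunctor`. The element `h.homEquiv (𝟙 M)` is the universal family over `M`. -/
def Utau {π : O} {hπ : π ≠ 0} {n r : ℕ} {M : Over (Spec (CommRingCat.of O))}
    (h : (localModelFunctor hπ n r).RepresentableBy M) : M.left.Opens :=
  tauLocus (family (h.homEquiv (𝟙 M)))

/-- The family `(F_i)_i` is the one attached to the alcove `τ`: for every `i`, the submodule `F_i`
of `Λ_{i,S}` is spanned by the `e^i_j` with `τ_i(j) = ω_i(j) + 1`. -/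
def IsTauFamily {n r : ℕ} {φ : Fin n → Matrix (Fin n) (Fin n) O}
    {S : Over (Spec (CommRingCat.of O))} (F : CompatibleFamily φ r S) : Prop :=
  ∀ (i : Fin n) (U : S.left.Opens), (F.sub i).sections U =
    Submodule.span Γ(S.left, U)
      ((fun j => (Pi.single j 1 : Fin n → Γ(S.left, U))) '' {j | tau r i j = omega i j + 1})

/-- The spectrum of an algebraic closure of the residue class field of `O`. -/
def geometricClosedPoint (O : Type u) [CommRing O] [IsLocalRing O] :
    Over (Spec (CommRingCat.of O)) :=
  Over.mk (Spec.map (CommRingCat.ofHom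
    ((algebraMap (IsLocalRing.ResidueField O)
      (AlgebraicClosure (IsLocalRing.ResidueField O))).comp (IsLocalRing.residue O))))

end Model

/-! ### The equations -/

section Equations

variable (O : Type u) [CommRing O] (n r : ℕ)

/-- The polynomial ring `O[a^i_κ; i = 0, …, n - 1, κ = 1, …, n - r]`. -/
abbrev PolyRing : Type u := MvPolynomial (Fin n × Fin (n - r)) O

/-- The `(n - r) × (n - r)`-matrix `A_i`: its first column is `(a^i_1, …, a^i_{n-r})`, the entries
just above the diagonal are `1`, and all other entries are `0`. -/
def companionMatrix (i : Fin n) : Matrix (Fin (n - r)) (Fin (n - r)) (PolyRing O n r) :=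
  Matrix.of fun μ ν =>
    if ν.1 = 0 then MvPolynomial.X (i, μ) else if μ.1 + 1 = ν.1 then 1 else 0

/-- The cyclic product `A_{k-1} ⋯ A_0 A_{n-1} ⋯ A_{k+1} A_k` of all the `n` matrices. -/
def cyclicProduct (k : Fin n) : Matrix (Fin (n - r)) (Fin (n - r)) (PolyRing O n r) :=
  (List.ofFn fun l : Fin n =>
    companionMatrix O n r ⟨(k.1 + (n - 1 - l.1)) % n, Nat.mod_lt _ k.pos⟩).prod

/-- The ideal `I` generated by the entries of all the matrices
`A_{k-1} ⋯ A_0 A_{n-1} ⋯ A_k - π`. -/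
def equationIdeal {O : Type u} [CommRing O] (π : O) (n r : ℕ) : Ideal (PolyRing O n r) :=
  Ideal.span {p | ∃ (k : Fin n) (μ ν : Fin (n - r)),
    p = (cyclicProduct O n r k - Matrix.scalar (Fin (n - r)) (MvPolynomial.C π) :
      Matrix (Fin (n - r)) (Fin (n - r)) (PolyRing O n r)) μ ν}

/-- The `O`-scheme `Spec O[a^i_κ] / I`. -/
def equationScheme {O : Type u} [CommRing O] (π : O) (n r : ℕ) : Over (Spec (CommRingCat.of O)) :=
  Over.mk (Spec.map (CommRingCat.ofHom
    (algebraMap O (PolyRing O n r ⧸ equationIdeal π n r))))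

end Equations

end LocalModel

end

/-! Put q = n - r. In the bases e^i the transition map φ_i is diagonal, with π at place i and 1
elsewhere. For every i split the indices into a block of r and a block of q elements. Where the
second block generates the quotient by F_i, this quotient is free on it, so F_i is the kernel of a
unique q × n matrix Q_i that is the identity on the columns of the second block. Compatibility says
that Q_{i+1} φ_i vanishes on ker Q_i, which is the image of the projector 1 - ι Q_i, where ι is the
inclusion of the second block. These are polynomial equations, so every choice of splittings gives
an affine chart.

Representability: over a residue field some r × r minor of a basis of F_i is nonzero, so the charts
cover. Each chart is an open subfunctor and subbundles glue in the Zariski topology, so the local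
criterion for representability applies (`isRepresentable_familyFunctor`).

The open subset U_τ is the chart whose i-th splitting consists of the cyclic intervals i, …, i + r -
1 and i + r, …, i + n - 1. Write A_i for the map induced by φ_i on the quotients, so that Q_{i+1}
φ_i = A_i Q_i (`IsChartDatum.step`). As φ_i carries the ν-th vector of the second block for i to the
(ν - 1)-st one for i + 1 when ν > 0, A_i has companion form and only its first column is free. Let ε
be the last basis vector of the quotient. Read column by column, the relation says that Q_i has the
column A_{i-1} ⋯ A_{i-k} ε at i - 1 - k for 0 ≤ k < n, and at the column where π stands it closes
the cycle: A_i A_{i-1} ⋯ A_{i+1} ε = π ε. Hence the first columns determine all Q_i, subject only to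
the last columns of the equations in the ideal. The other columns follow
(`companionProd_eq_scalar_iff`), because products of the A_i carry ε to every basis vector. So the
chart datum over the equation ring is universal (`isUniversalDatum_equationCoord`), and two
universal families are isomorphic.

The worst point is the origin of this chart: all first columns vanish, which is allowed because π =
0 in k. -/

noncomputable section

namespace LocalModel

/-! ### Coordinate inclusions -/

section Coordinates

variable {r q n : ℕ} (e : Fin r ⊕ Fin q ≃ Fin n) (A : Type*) [CommRing A]

/-- The inclusion of the coordinates in the first block of the decomposition `e`. -/
def inlMatrix : Matrix (Fin n) (Fin r) A := (1 : Matrix (Fin n) (Fin n) A).submatrix id (e ∘ Sum.inl)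

/-- The inclusion of the coordinates in the second block of the decomposition `e`. -/
def inrMatrix : Matrix (Fin n) (Fin q) A := (1 : Matrix (Fin n) (Fin n) A).submatrix id (e ∘ Sum.inr)

variable {A}

theorem mul_inlMatrix {l : Type*} (Q : Matrix l (Fin n) A) :
    Q * inlMatrix e A = Q.submatrix id (e ∘ Sum.inl) := by
  rw [inlMatrix, ← Matrix.submatrix_id_id Q, ← Matrix.submatrix_mul _ _ _ _ _ Function.bijective_id]
  simp

theorem mul_inrMatrix {l : Type*} (Q : Matrix l (Fin n) A) :
    Q * inrMatrix e A = Q.submatrix id (e ∘ Sum.inr) := by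
  rw [inrMatrix, ← Matrix.submatrix_id_id Q, ← Matrix.submatrix_mul _ _ _ _ _ Function.bijective_id]
  simp

theorem inlMatrix_transpose_mul {l : Type*} (Q : Matrix (Fin n) l A) :
    (inlMatrix e A).transpose * Q = Q.submatrix (e ∘ Sum.inl) id := by
  rw [← Matrix.transpose_inj, Matrix.transpose_mul, Matrix.transpose_transpose, mul_inlMatrix]
  rfl

theorem inrMatrix_transpose_mul {l : Type*} (Q : Matrix (Fin n) l A) :
    (inrMatrix e A).transpose * Q = Q.submatrix (e ∘ Sum.inr) id := by
  rw [← Matrix.transpose_inj, Matrix.transpose_mul, Matrix.transpose_transpose, mul_inrMatrix]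
  rfl

theorem inlMatrix_transpose_mul_inlMatrix : (inlMatrix e A).transpose * inlMatrix e A = 1 := by
  rw [inlMatrix_transpose_mul, inlMatrix, Matrix.submatrix_submatrix]
  exact Matrix.submatrix_one _ (e.injective.comp Sum.inl_injective)

theorem inrMatrix_transpose_mul_inrMatrix : (inrMatrix e A).transpose * inrMatrix e A = 1 := by
  rw [inrMatrix_transpose_mul, inrMatrix, Matrix.submatrix_submatrix]
  exact Matrix.submatrix_one _ (e.injective.comp Sum.inr_injective)

theorem inlMatrix_transpose_mul_inrMatrix : (inlMatrix e A).transpose * inrMatrix e A = 0 := by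
  ext a b
  rw [inlMatrix_transpose_mul, inrMatrix]
  simp

theorem inrMatrix_transpose_mul_inlMatrix : (inrMatrix e A).transpose * inlMatrix e A = 0 := by
  ext a b
  rw [inrMatrix_transpose_mul, inlMatrix]
  simp

theorem inlMatrix_add_inrMatrix :
    inlMatrix e A * (inlMatrix e A).transpose + inrMatrix e A * (inrMatrix e A).transpose = 1 := by
  ext a b
  obtain ⟨a, rfl⟩ := e.surjective a
  obtain ⟨b, rfl⟩ := e.surjective b
  simp only [Matrix.add_apply, Matrix.mul_apply, inlMatrix, inrMatrix, Matrix.transpose_apply,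
    Matrix.submatrix_apply, id, Matrix.one_apply, Function.comp_apply, e.injective.eq_iff]
  rcases a with a | a <;> rcases b with b | b <;> simp [eq_comm]

theorem inlMatrix_map {A' : Type*} [CommRing A'] (f : A →+* A') :
    (inlMatrix e A).map f = inlMatrix e A' := by
  rw [inlMatrix, inlMatrix, ← Matrix.submatrix_map, Matrix.map_one _ (map_zero f) (map_one f)]

theorem inrMatrix_map {A' : Type*} [CommRing A'] (f : A →+* A') :
    (inrMatrix e A).map f = inrMatrix e A' := by
  rw [inrMatrix, inrMatrix, ← Matrix.submatrix_map, Matrix.map_one _ (map_zero f) (map_one f)]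

theorem range_inlMatrix :
    LinearMap.range (inlMatrix e A).mulVecLin =
      Submodule.span A ((fun j => (Pi.single j 1 : Fin n → A)) '' Set.range (e ∘ Sum.inl)) := by
  rw [Matrix.range_mulVecLin, ← Set.range_comp]
  congr 2
  ext k j
  simp [inlMatrix, Matrix.col, Matrix.one_apply, Pi.single_apply]

theorem range_inrMatrix :
    LinearMap.range (inrMatrix e A).mulVecLin =
      Submodule.span A ((fun j => (Pi.single j 1 : Fin n → A)) '' Set.range (e ∘ Sum.inr)) := by
  rw [Matrix.range_mulVecLin, ← Set.range_comp]
  congr 2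
  ext k j
  simp [inrMatrix, Matrix.col, Matrix.one_apply, Pi.single_apply]

/-- Identifies the member of the family at the origin of the chart of τ. -/
theorem ker_inrMatrix_transpose (s : Fin n → A) :
    (inrMatrix e A).transpose.mulVec s = 0 ↔
      s ∈ Submodule.span A ((fun j => (Pi.single j 1 : Fin n → A)) '' Set.range (e ∘ Sum.inl)) := by
  rw [← range_inlMatrix]
  constructor
  · intro hs
    refine ⟨(inlMatrix e A).transpose.mulVec s, ?_⟩
    have h1 := congrArg (fun M => M.mulVec s) (inlMatrix_add_inrMatrix (A := A) e)
    simp only [Matrix.add_mulVec, ← Matrix.mulVec_mulVec, hs, Matrix.mulVec_zero, add_zero,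
      Matrix.one_mulVec] at h1
    exact h1
  · rintro ⟨d, rfl⟩
    rw [Matrix.mulVecLin_apply, Matrix.mulVec_mulVec, inrMatrix_transpose_mul_inlMatrix,
      Matrix.zero_mulVec]

end Coordinates

/-! ### Subbundles as kernels of normalized matrices -/

section Kernels

variable {S T : Scheme.{u}} {n r q : ℕ}

theorem resMat_mul {l m k : ℕ} {U V : S.Opens} (h : V ≤ U) (B : Matrix (Fin l) (Fin m) Γ(S, U))
    (C : Matrix (Fin m) (Fin k) Γ(S, U)) : resMat h (B * C) = resMat h B * resMat h C :=
  Matrix.map_mul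

theorem resMat_sub {l m : ℕ} {U V : S.Opens} (h : V ≤ U) (B C : Matrix (Fin l) (Fin m) Γ(S, U)) :
    resMat h (B - C) = resMat h B - resMat h C :=
  Matrix.map_sub _ (map_sub _) _ _

theorem resMat_one {l : ℕ} {U V : S.Opens} (h : V ≤ U) :
    resMat h (1 : Matrix (Fin l) (Fin l) Γ(S, U)) = 1 :=
  Matrix.map_one _ (map_zero _) (map_one _)

theorem resMat_zero {l m : ℕ} {U V : S.Opens} (h : V ≤ U) :
    resMat h (0 : Matrix (Fin l) (Fin m) Γ(S, U)) = 0 :=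
  Matrix.map_zero _ (map_zero _)

theorem resMat_self {l m : ℕ} {U : S.Opens} (h : U ≤ U) (B : Matrix (Fin l) (Fin m) Γ(S, U)) :
    resMat h B = B := by
  ext i j
  exact congrFun (resVec_self h fun j => B i j) j

theorem resMat_inlMatrix (e : Fin r ⊕ Fin q ≃ Fin n) {U V : S.Opens} (h : V ≤ U) :
    resMat h (inlMatrix e Γ(S, U)) = inlMatrix e Γ(S, V) :=
  inlMatrix_map e _

theorem resMat_inrMatrix (e : Fin r ⊕ Fin q ≃ Fin n) {U V : S.Opens} (h : V ≤ U) :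
    resMat h (inrMatrix e Γ(S, U)) = inrMatrix e Γ(S, V) :=
  inrMatrix_map e _

theorem resMat_transpose {l m : ℕ} {U V : S.Opens} (h : V ≤ U) (B : Matrix (Fin l) (Fin m) Γ(S, U)) :
    resMat h B.transpose = (resMat h B).transpose := rfl

namespace Subbundle

/-- Over `U`, the subsheaf `F` is the image of the matrix `B`. -/
def IsRangeOn (F : Subbundle S n r) (U : S.Opens) (B : Matrix (Fin n) (Fin r) Γ(S, U)) : Prop :=
  ∀ (V : S.Opens) (h : V ≤ U), F.sections V = LinearMap.range (resMat h B).mulVecLin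

/-- Over `U`, the subsheaf `F` is the kernel of the matrix `Q`. -/
def IsKerOn (F : Subbundle S n r) (U : S.Opens) (Q : Matrix (Fin q) (Fin n) Γ(S, U)) : Prop :=
  ∀ (V : S.Opens) (h : V ≤ U) (s : Fin n → Γ(S, V)),
    s ∈ F.sections V ↔ (resMat h Q).mulVec s = 0

theorem IsKerOn.res {F : Subbundle S n r} {U V : S.Opens} {Q : Matrix (Fin q) (Fin n) Γ(S, U)}
    (hF : F.IsKerOn U Q) (h : V ≤ U) : F.IsKerOn V (resMat h Q) := by
  intro W hW s
  rw [resMat_resMat]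
  exact hF W _ s

/-- The subbundle which is the kernel of a matrix that is the identity on some coordinates. -/
def ofKer (e : Fin r ⊕ Fin q ≃ Fin n) (Q : Matrix (Fin q) (Fin n) Γ(S, ⊤))
    (hQ : Q * inrMatrix e Γ(S, ⊤) = 1) : Subbundle S n r where
  sections U := LinearMap.ker (resMat le_top Q : Matrix _ _ Γ(S, U)).mulVecLin
  res_mem := by
    intro U V h s hs
    rw [LinearMap.mem_ker, Matrix.mulVecLin_apply] at hs ⊢
    rw [← resMat_resMat le_top h Q, ← resVec_mulVec, hs, resVec_zero]
  glue := by
    intro U s H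
    rw [LinearMap.mem_ker, Matrix.mulVecLin_apply]
    refine eq_of_locally_eq _ _ fun x hx => ?_
    obtain ⟨V, h, hxV, hV⟩ := H x hx
    refine ⟨V, h, hxV, ?_⟩
    rw [LinearMap.mem_ker, Matrix.mulVecLin_apply] at hV
    rw [resVec_mulVec, resMat_resMat, hV, resVec_zero]
  locally_split := by
    intro x
    -- The projector onto the kernel, restricted to the first block, is a frame of the kernel. The
    -- first coordinates invert it, as the correction term lies in the second block.
    refine ⟨⊤, trivial, (1 - inrMatrix e Γ(S, ⊤) * Q) * inlMatrix e Γ(S, ⊤), (inlMatrix e Γ(S, ⊤)).transpose, ?_, ?_⟩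
    · rw [Matrix.sub_mul, Matrix.one_mul, Matrix.mul_sub, inlMatrix_transpose_mul_inlMatrix,
        ← Matrix.mul_assoc, ← Matrix.mul_assoc, inlMatrix_transpose_mul_inrMatrix, Matrix.zero_mul,
        Matrix.zero_mul, sub_zero]
    · intro V h
      have hQV := congrArg (resMat h) hQ
      rw [resMat_mul, resMat_inrMatrix, resMat_one] at hQV
      rw [resMat_mul, resMat_sub, resMat_mul, resMat_one, resMat_inrMatrix, resMat_inlMatrix]
      generalize resMat h Q = Q' at hQV
      ext s
      rw [LinearMap.mem_ker, LinearMap.mem_range, Matrix.mulVecLin_apply]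
      constructor
      · intro hs
        refine ⟨(inlMatrix e Γ(S, V)).transpose.mulVec s, ?_⟩
        -- The projection to the first block is 1 minus the projection to the second, and the
        -- projector 1 - ι Q' kills the second block because Q' ι = 1.
        rw [Matrix.mulVecLin_apply, Matrix.mulVec_mulVec, Matrix.mul_assoc,
          ← add_sub_cancel_right (inlMatrix e Γ(S, V) * (inlMatrix e Γ(S, V)).transpose)
            (inrMatrix e Γ(S, V) * (inrMatrix e Γ(S, V)).transpose), inlMatrix_add_inrMatrix, Matrix.mul_sub,
          Matrix.mul_one, ← Matrix.mul_assoc, Matrix.sub_mul, Matrix.one_mul, Matrix.mul_assoc _ Q',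
          hQV, Matrix.mul_one, sub_self, Matrix.zero_mul, sub_zero, Matrix.sub_mulVec,
          ← Matrix.mulVec_mulVec, hs, Matrix.mulVec_zero, sub_zero, Matrix.one_mulVec]
      · rintro ⟨c, rfl⟩
        rw [Matrix.mulVecLin_apply, Matrix.mulVec_mulVec, ← Matrix.mul_assoc, Matrix.mul_sub,
          ← Matrix.mul_assoc, hQV, Matrix.one_mul, Matrix.mul_one, sub_self, Matrix.zero_mul,
          Matrix.zero_mulVec]

theorem isKerOn_ofKer (e : Fin r ⊕ Fin q ≃ Fin n) (Q : Matrix (Fin q) (Fin n) Γ(S, ⊤))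
    (hQ : Q * inrMatrix e Γ(S, ⊤) = 1) : (ofKer e Q hQ).IsKerOn ⊤ Q := by
  intro V h s
  rfl

theorem eq_of_isKerOn {F G : Subbundle S n r} {Q : Matrix (Fin q) (Fin n) Γ(S, ⊤)}
    (hF : F.IsKerOn ⊤ Q) (hG : G.IsKerOn ⊤ Q) : F = G := by
  ext U s
  rw [hF U le_top, hG U le_top]

/-- Uniqueness of the normalized matrix. It makes local matrices glue and makes the entries
coordinates on a chart. -/
theorem IsKerOn.eq {F : Subbundle S n r} {U : S.Opens} (e : Fin r ⊕ Fin q ≃ Fin n)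
    {Q Q' : Matrix (Fin q) (Fin n) Γ(S, U)} (hF : F.IsKerOn U Q) (hF' : F.IsKerOn U Q')
    (hQ : Q * inrMatrix e Γ(S, U) = 1) (hQ' : Q' * inrMatrix e Γ(S, U) = 1) : Q = Q' := by
  -- The columns of the projector 1 - ι Q lie in F, and Q' kills F.
  have key : Q' * (1 - inrMatrix e Γ(S, U) * Q) = 0 := by
    apply Matrix.ext_of_mulVec_single
    intro j
    rw [← Matrix.mulVec_mulVec, Matrix.zero_mulVec]
    have h := hF' U le_rfl ((1 - inrMatrix e Γ(S, U) * Q).mulVec (Pi.single j 1))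
    rw [resMat_self] at h
    rw [← h, hF U le_rfl, resMat_self, Matrix.mulVec_mulVec, Matrix.mul_sub, ← Matrix.mul_assoc, hQ,
      Matrix.one_mul, Matrix.mul_one, sub_self, Matrix.zero_mulVec]
  rw [Matrix.mul_sub, Matrix.mul_one, ← Matrix.mul_assoc, hQ', Matrix.one_mul, sub_eq_zero] at key
  exact key.symm

theorem IsKerOn.sup_eq_top {F : Subbundle S n r} {U : S.Opens} (e : Fin r ⊕ Fin q ≃ Fin n)
    {Q : Matrix (Fin q) (Fin n) Γ(S, U)} (hF : F.IsKerOn U Q) (hQ : Q * inrMatrix e Γ(S, U) = 1) :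
    F.sections U ⊔ Submodule.span Γ(S, U)
      ((fun j => (Pi.single j 1 : Fin n → Γ(S, U))) '' Set.range (e ∘ Sum.inr)) = ⊤ := by
  rw [← range_inrMatrix, eq_top_iff]
  intro s _
  have : s = (1 - inrMatrix e Γ(S, U) * Q).mulVec s + (inrMatrix e Γ(S, U)).mulVec (Q.mulVec s) := by
    rw [Matrix.sub_mulVec, Matrix.one_mulVec, ← Matrix.mulVec_mulVec, sub_add_cancel]
  rw [this]
  refine Submodule.add_mem_sup ?_ ⟨Q.mulVec s, rfl⟩
  rw [hF U le_rfl, resMat_self, Matrix.mulVec_mulVec, Matrix.mul_sub, ← Matrix.mul_assoc, hQ,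
      Matrix.one_mul, Matrix.mul_one, sub_self, Matrix.zero_mulVec]

theorem IsKerOn.le_generatedLocus {F : Subbundle S n r} {U : S.Opens} (e : Fin r ⊕ Fin q ≃ Fin n)
    {Q : Matrix (Fin q) (Fin n) Γ(S, U)} (hF : F.IsKerOn U Q) (hQ : Q * inrMatrix e Γ(S, U) = 1) :
    U ≤ F.generatedLocus (Set.range (e ∘ Sum.inr)) :=
  fun _ hx => ⟨U, hx, hF.sup_eq_top e hQ⟩

/-- If F and the second block span everything near x, then the projection of F to the first block is
surjective. For a frame B this is a square matrix with a right inverse, so its determinant is a unit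
near x. -/
theorem IsRangeOn.mem_basicOpen {F : Subbundle S n r} {U : S.Opens} (e : Fin r ⊕ Fin q ≃ Fin n)
    {B : Matrix (Fin n) (Fin r) Γ(S, U)} (hF : F.IsRangeOn U B) {x : S} (hxU : x ∈ U)
    (hx : x ∈ F.generatedLocus (Set.range (e ∘ Sum.inr))) :
    x ∈ S.basicOpen ((inlMatrix e Γ(S, U)).transpose * B).det := by
  obtain ⟨V, hxV, hV⟩ := hx
  rw [← range_inrMatrix] at hV
  -- Write the k-th vector of the first block as a section of F plus a combination of the second
  -- block, and keep the first coordinates.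
  have hW : ∀ k : Fin r, ∃ c : Fin r → Γ(S, U ⊓ V),
      ((inlMatrix e Γ(S, U ⊓ V)).transpose * resMat (inf_le_left : U ⊓ V ≤ U) B).mulVec c = Pi.single k 1 := by
    intro k
    have h1 : (inlMatrix e Γ(S, V)).mulVec (Pi.single k 1) ∈
        (⊤ : Submodule Γ(S, V) (Fin n → Γ(S, V))) := trivial
    rw [← hV] at h1
    obtain ⟨y, hy, z, ⟨d, rfl⟩, hyz⟩ := Submodule.mem_sup.mp h1
    have hy' := F.res_mem (inf_le_right : U ⊓ V ≤ V) y hy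
    rw [hF _ inf_le_left] at hy'
    obtain ⟨c, hc⟩ := hy'
    refine ⟨c, ?_⟩
    have h2 := congrArg (resVec (inf_le_right : U ⊓ V ≤ V)) hyz
    rw [resVec_add, ← hc, Matrix.mulVecLin_apply, Matrix.mulVecLin_apply, resVec_mulVec,
      resVec_mulVec, resMat_inrMatrix, resMat_inlMatrix] at h2
    have h3 := congrArg (inlMatrix e Γ(S, U ⊓ V)).transpose.mulVec h2
    rw [Matrix.mulVec_add, Matrix.mulVec_mulVec, Matrix.mulVec_mulVec, Matrix.mulVec_mulVec,
      inlMatrix_transpose_mul_inrMatrix, inlMatrix_transpose_mul_inlMatrix, Matrix.zero_mulVec,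
      add_zero, Matrix.one_mulVec] at h3
    rw [h3]
    funext j
    rw [resVec, Pi.single_apply, Pi.single_apply]
    split_ifs <;> simp
  choose c hc using hW
  have hunit : IsUnit ((inlMatrix e Γ(S, U ⊓ V)).transpose * resMat (inf_le_left : U ⊓ V ≤ U) B).det := by
    refine IsUnit.of_mul_eq_one (Matrix.of fun i k => c k i).det ?_
    rw [← Matrix.det_mul]
    convert Matrix.det_one (n := Fin r) (R := Γ(S, U ⊓ V))
    apply Matrix.ext_of_mulVec_single
    intro k
    rw [← Matrix.mulVec_mulVec, Matrix.one_mulVec]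
    rw [Matrix.mulVec_single_one]
    exact hc k
  have h4 := S.basicOpen_of_isUnit hunit
  have h5 : ((inlMatrix e Γ(S, U ⊓ V)).transpose * resMat (inf_le_left : U ⊓ V ≤ U) B).det =
      (S.presheaf.map (homOfLE (inf_le_left : U ⊓ V ≤ U)).op).hom
        ((inlMatrix e Γ(S, U)).transpose * B).det := by
    rw [RingHom.map_det, ← resMat_inlMatrix e (inf_le_left : U ⊓ V ≤ U), ← resMat_transpose,
      ← resMat_mul]
    rfl
  rw [h5] at h4
  have h6 := S.basicOpen_res ((inlMatrix e Γ(S, U)).transpose * B).det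
    (homOfLE (inf_le_left : U ⊓ V ≤ U)).op
  have : x ∈ U ⊓ V := ⟨hxU, hxV⟩
  rw [← h4] at this
  exact (h6 ▸ this : x ∈ (U ⊓ V) ⊓ _).2

/-- Where the minor D on the first block is invertible, B D⁻¹ is a frame in graph form over the
first block, and F is the kernel of second coordinates minus B₂ D⁻¹ times first coordinates, with B₂
the second block of rows of B. -/
theorem IsRangeOn.exists_isKerOn {F : Subbundle S n r} {U : S.Opens} (e : Fin r ⊕ Fin q ≃ Fin n)
    {B : Matrix (Fin n) (Fin r) Γ(S, U)} (hF : F.IsRangeOn U B) {x : S}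
    (hx : x ∈ S.basicOpen ((inlMatrix e Γ(S, U)).transpose * B).det) :
    ∃ (V : S.Opens) (Q : Matrix (Fin q) (Fin n) Γ(S, V)), x ∈ V ∧ Q * inrMatrix e Γ(S, V) = 1 ∧
      F.IsKerOn V Q := by
  set V := S.basicOpen ((inlMatrix e Γ(S, U)).transpose * B).det with hV
  have hVU : V ≤ U := S.basicOpen_le _
  have hunit : IsUnit ((inlMatrix e Γ(S, V)).transpose * resMat hVU B).det := by
    have h5 : ((inlMatrix e Γ(S, V)).transpose * resMat hVU B).det =
        (S.presheaf.map (homOfLE hVU).op).hom ((inlMatrix e Γ(S, U)).transpose * B).det := by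
      rw [RingHom.map_det, ← resMat_inlMatrix e hVU, ← resMat_transpose, ← resMat_mul]
      rfl
    rw [h5]
    exact RingedSpace.isUnit_res_basicOpen _ _
  set D := (inlMatrix e Γ(S, V)).transpose * resMat hVU B with hD
  have hXD : D⁻¹ * D = 1 := Matrix.nonsing_inv_mul D hunit
  have hDX : D * D⁻¹ = 1 := Matrix.mul_nonsing_inv D hunit
  set Q := (inrMatrix e Γ(S, V)).transpose * (1 - resMat hVU B * D⁻¹ * (inlMatrix e Γ(S, V)).transpose) with hQ
  -- The complementary projector has no component in the first block, so it factors through Q. Hence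
  -- a vector killed by Q lies in the image of B.
  have hQ1 : 1 - resMat hVU B * D⁻¹ * (inlMatrix e Γ(S, V)).transpose = inrMatrix e Γ(S, V) * Q := by
    rw [hQ, ← Matrix.mul_assoc, eq_sub_of_add_eq' (inlMatrix_add_inrMatrix (A := Γ(S, V)) e),
      Matrix.sub_mul, Matrix.one_mul, eq_comm, sub_eq_self, Matrix.mul_assoc, Matrix.mul_sub,
      Matrix.mul_one, ← Matrix.mul_assoc, ← Matrix.mul_assoc, ← hD, hDX, Matrix.one_mul, sub_self,
      Matrix.mul_zero]
  refine ⟨V, Q, hx, ?_, ?_⟩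
  · rw [hQ, Matrix.mul_assoc, Matrix.sub_mul, Matrix.mul_assoc, inlMatrix_transpose_mul_inrMatrix,
      Matrix.mul_zero, sub_zero, Matrix.one_mul, inrMatrix_transpose_mul_inrMatrix]
  · intro W hW s
    rw [hF W (hW.trans hVU)]
    constructor
    · rintro ⟨c, rfl⟩
      rw [← resMat_resMat hVU hW, Matrix.mulVecLin_apply, Matrix.mulVec_mulVec, ← resMat_mul, hQ,
        Matrix.mul_assoc, Matrix.sub_mul, Matrix.mul_assoc _ (inlMatrix e Γ(S, V)).transpose, ← hD,
        Matrix.mul_assoc, hXD, Matrix.mul_one, Matrix.one_mul, sub_self, Matrix.mul_zero,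
        resMat_zero, Matrix.zero_mulVec]
    · intro hs
      have h1 := congrArg (fun M => (resMat hW M).mulVec s) hQ1
      simp only [resMat_sub, resMat_mul, resMat_one] at h1
      rw [← Matrix.mulVec_mulVec, hs, Matrix.mulVec_zero, Matrix.sub_mulVec, Matrix.one_mulVec,
        sub_eq_zero, resMat_resMat, Matrix.mul_assoc, ← Matrix.mulVec_mulVec] at h1
      exact ⟨_, h1.symm⟩

theorem exists_isKerOn_of_mem_generatedLocus (F : Subbundle S n r) (e : Fin r ⊕ Fin q ≃ Fin n)
    {x : S} (hx : x ∈ F.generatedLocus (Set.range (e ∘ Sum.inr))) :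
    ∃ (V : S.Opens) (Q : Matrix (Fin q) (Fin n) Γ(S, V)), x ∈ V ∧ Q * inrMatrix e Γ(S, V) = 1 ∧
      F.IsKerOn V Q := by
  obtain ⟨U, hxU, B, _, _, hB⟩ := F.locally_split x
  have hB' : F.IsRangeOn U B := hB
  exact hB'.exists_isKerOn e (hB'.mem_basicOpen e hxU hx)

end Subbundle

end Kernels

/-! ### Generated loci: covering, global normalized matrices, base change -/

section Loci

variable {S T : Scheme.{u}} {n r q : ℕ}

/-- As C B = 1, the rows of B span k^r. Rows that form a basis give the first block. -/
theorem exists_equiv_isUnit_det {k : Type*} [Field k] (hn : n = r + q)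
    (B : Matrix (Fin n) (Fin r) k) (C : Matrix (Fin r) (Fin n) k) (hCB : C * B = 1) :
    ∃ e : Fin r ⊕ Fin q ≃ Fin n, IsUnit ((inlMatrix e k).transpose * B).det := by
  obtain ⟨κ, a, ha, hspan, hli⟩ := exists_linearIndependent' k B.row
  have htop : Submodule.span k (Set.range B.row) = ⊤ := by
    rw [← range_vecMulLinear, eq_top_iff]
    intro w _
    refine ⟨Matrix.vecMul w C, ?_⟩
    rw [Matrix.vecMulLinear_apply, Matrix.vecMul_vecMul, hCB, Matrix.vecMul_one]
  rw [htop] at hspan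
  let b := Module.Basis.mk hli hspan.ge
  have : Fintype κ := Fintype.ofInjective a ha
  have hcard : Fintype.card κ = r := by
    rw [← Module.finrank_eq_card_basis b, Module.finrank_fin_fun]
  let g : Fin r ≃ κ := (Fintype.equivFinOfCardEq hcard).symm
  let σ : Fin r → Fin n := a ∘ g
  have hσ : Function.Injective σ := ha.comp g.injective
  classical
  have hc : Fintype.card ↥(Set.range σ)ᶜ = q := by
    rw [Fintype.card_compl_set, Set.card_range_of_injective hσ, Fintype.card_fin, Fintype.card_fin,
      hn, Nat.add_sub_cancel_left]
  let e : Fin r ⊕ Fin q ≃ Fin n :=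
    (Equiv.sumCongr (Equiv.ofInjective σ hσ) (Fintype.equivFinOfCardEq hc).symm).trans
      (Equiv.Set.sumCompl (Set.range σ))
  refine ⟨e, ?_⟩
  rw [inlMatrix_transpose_mul, ← Matrix.isUnit_iff_isUnit_det,
    ← Matrix.linearIndependent_rows_iff_isUnit]
  exact hli.comp g g.injective

namespace Subbundle

/-- A minor that does not vanish in the residue field at x is invertible near x. This is why the
charts cover. -/
theorem exists_mem_generatedLocus (hn : n = r + q) (F : Subbundle S n r) (x : S) :
    ∃ e : Fin r ⊕ Fin q ≃ Fin n, x ∈ F.generatedLocus (Set.range (e ∘ Sum.inr)) := by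
  obtain ⟨U, hxU, B, C, hCB, hB⟩ := F.locally_split x
  have hB' : F.IsRangeOn U B := hB
  let ev := (S.evaluation U x hxU).hom
  obtain ⟨e, he⟩ := exists_equiv_isUnit_det hn (B.map ev) (C.map ev)
    (by rw [← Matrix.map_mul, hCB, Matrix.map_one _ (map_zero _) (map_one _)])
  have hx : x ∈ S.basicOpen ((inlMatrix e Γ(S, U)).transpose * B).det := by
    rw [← S.evaluation_ne_zero_iff_mem_basicOpen x hxU]
    have h1 : ev ((inlMatrix e Γ(S, U)).transpose * B).det =
        ((inlMatrix e (S.residueField x)).transpose * B.map ev).det := by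
      rw [RingHom.map_det, RingHom.mapMatrix_apply, Matrix.map_mul, ← inlMatrix_map e ev]
      rfl
    change ev _ ≠ 0
    rw [h1]
    exact he.ne_zero
  obtain ⟨V, Q, hxV, hQ, hV⟩ := hB'.exists_isKerOn e hx
  exact ⟨e, hV.le_generatedLocus e hQ hxV⟩

theorem exists_isKerOn_top (F : Subbundle S n r) (e : Fin r ⊕ Fin q ≃ Fin n)
    (H : ∀ x, x ∈ F.generatedLocus (Set.range (e ∘ Sum.inr))) :
    ∃ Q : Matrix (Fin q) (Fin n) Γ(S, ⊤), Q * inrMatrix e Γ(S, ⊤) = 1 ∧ F.IsKerOn ⊤ Q := by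
  choose V Q hxV hQ hV using fun x => F.exists_isKerOn_of_mem_generatedLocus e (H x)
  have hcov : (⊤ : S.Opens) ≤ iSup V := fun x _ => Opens.mem_iSup.mpr ⟨x, hxV x⟩
  have hres : ∀ {U W : S.Opens} (h : W ≤ U) {M : Matrix (Fin q) (Fin n) Γ(S, U)},
      M * inrMatrix e Γ(S, U) = 1 → resMat h M * inrMatrix e Γ(S, W) = 1 := by
    intro U W h M hM
    rw [← resMat_inrMatrix e h, ← resMat_mul, hM, resMat_one]
  have hcompat : ∀ a b, TopCat.Presheaf.IsCompatible S.sheaf.1 V (fun x => Q x a b) := by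
    intro a b x y
    -- On overlaps both matrices are normalized and have the same kernel, so they agree.
    have := IsKerOn.eq e ((hV x).res inf_le_left) ((hV y).res (inf_le_right : V x ⊓ V y ≤ V y))
      (hres _ (hQ x)) (hres _ (hQ y))
    exact congrFun (congrFun this a) b
  have hglue : ∀ a b, ∃ s : Γ(S, ⊤), ∀ x, (S.presheaf.map (homOfLE (le_top : V x ≤ ⊤)).op).hom s =
      Q x a b := fun a b => (S.sheaf.existsUnique_gluing' V ⊤ (fun x => homOfLE le_top) hcov
    (fun x => Q x a b) (hcompat a b)).exists
  choose M hM using hglue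
  have hMQ : ∀ x, resMat le_top (Matrix.of M) = Q x := by
    intro x
    ext a b
    exact hM a b x
  refine ⟨Matrix.of M, ?_, ?_⟩
  · ext a b
    refine congrFun (eq_of_locally_eq (fun b => ((Matrix.of M) * inrMatrix e Γ(S, ⊤)) a b)
      (fun b => (1 : Matrix (Fin q) (Fin q) Γ(S, ⊤)) a b) fun x _ =>
        ⟨V x, le_top, hxV x, ?_⟩) b
    have h1 : resMat le_top ((Matrix.of M) * inrMatrix e Γ(S, ⊤)) =
        resMat (le_top : V x ≤ ⊤) (1 : Matrix (Fin q) (Fin q) Γ(S, ⊤)) := by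
      rw [resMat_mul, hMQ, resMat_inrMatrix, hQ, resMat_one]
    exact congrFun h1 a
  · intro W hW s
    constructor
    · intro hs
      refine eq_of_locally_eq _ _ fun x hx => ⟨W ⊓ V x, inf_le_left, ⟨hx, hxV x⟩, ?_⟩
      have h1 := F.res_mem (inf_le_left : W ⊓ V x ≤ W) s hs
      rw [hV x _ inf_le_right, ← hMQ, resMat_resMat] at h1
      rw [resVec_mulVec, resMat_resMat, h1, resVec_zero]
    · intro hs
      refine F.glue W s fun x hx => ⟨W ⊓ V x, inf_le_left, ⟨hx, hxV x⟩, ?_⟩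
      have h1 := congrArg (resVec (inf_le_left : W ⊓ V x ≤ W)) hs
      rw [hV x _ inf_le_right, ← hMQ, resMat_resMat]
      rwa [resVec_mulVec, resMat_resMat, resVec_zero] at h1

theorem pullVec_mem_pullback (F : Subbundle S n r) (f : T ⟶ S) {U : S.Opens} {V : T.Opens}
    (e : V ≤ f ⁻¹ᵁ U) (s : Fin n → Γ(S, U)) (hs : s ∈ F.sections U) :
    pullVec f U V e s ∈ (F.pullback f).sections V :=
  F.pullVec_mem_pullSections f e s hs

/-- Kernels need not commute with pullback. Here `P` and `X` exhibit ker Q as the image of P, and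
images do. -/
theorem IsKerOn.pullback {F : Subbundle S n r} {U : S.Opens} {Q : Matrix (Fin q) (Fin n) Γ(S, U)}
    (hF : F.IsKerOn U Q) (P : Matrix (Fin n) (Fin n) Γ(S, U)) (X : Matrix (Fin n) (Fin q) Γ(S, U))
    (hQP : Q * P = 0) (hX : P + X * Q = 1) (f : T ⟶ S) (V : T.Opens) (e : V ≤ f ⁻¹ᵁ U) :
    (F.pullback f).IsKerOn V (Q.map (f.appLE U V e).hom) := by
  intro W hW s
  rw [resMat_map_appLE]
  constructor
  · intro hs
    refine eq_of_locally_eq _ _ fun x hx => ?_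
    obtain ⟨V', h, hxV', U', e', hs'⟩ := hs x hx
    refine ⟨V', h, hxV', ?_⟩
    have e'' : V' ≤ f ⁻¹ᵁ (U' ⊓ U) := fun y hy => ⟨e' hy, e (hW (h hy))⟩
    have h1 := F.resVec_mem_pullSpan f e' e'' inf_le_left le_rfl _ hs'
    rw [resVec_self] at h1
    rw [resVec_mulVec, resMat_map_appLE, resVec_zero]
    have hle : F.pullSpan f (U' ⊓ U) V' e'' ≤
        LinearMap.ker (Q.map (f.appLE U V' (h.trans (hW.trans e))).hom).mulVecLin := by
      refine Submodule.span_le.mpr ?_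
      rintro _ ⟨t, ht, rfl⟩
      rw [SetLike.mem_coe, hF _ inf_le_right] at ht
      rw [SetLike.mem_coe, LinearMap.mem_ker, Matrix.mulVecLin_apply]
      have hB : (resMat inf_le_right Q : Matrix _ _ Γ(S, U' ⊓ U)).map
          (f.appLE (U' ⊓ U) V' e'').hom = Q.map (f.appLE U V' (h.trans (hW.trans e))).hom := by
        ext i j
        simp only [resMat, Matrix.map_apply]
        rw [← CommRingCat.comp_apply, Scheme.Hom.map_appLE]
      rw [← hB, ← pullVec_mulVec, ht]
      funext j
      simp [pullVec]
    exact hle h1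
  · intro hs
    -- From P + X Q = 1, a vector killed by Q is fixed by P, hence a combination of pulled back
    -- columns of P, which are sections of F.
    have h1 : s = (P.map (f.appLE U W (hW.trans e)).hom).mulVec s := by
      have h2 := congrArg (fun M => (M.map (f.appLE U W (hW.trans e)).hom).mulVec s) hX
      simp only [Matrix.map_add _ (map_add (f.appLE U W (hW.trans e)).hom), Matrix.map_mul,
        Matrix.add_mulVec, ← Matrix.mulVec_mulVec, hs, Matrix.mulVec_zero, add_zero,
        Matrix.map_one _ (map_zero (f.appLE U W (hW.trans e)).hom) (map_one _),
        Matrix.one_mulVec] at h2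
      exact h2.symm
    rw [h1, Matrix.mulVec_eq_sum]
    refine Submodule.sum_mem _ fun k _ => ?_
    rw [op_smul_eq_smul]
    refine Submodule.smul_mem _ _ ?_
    have h2 : P.mulVec (Pi.single k 1) ∈ F.sections U := by
      rw [hF U le_rfl, resMat_self, Matrix.mulVec_mulVec, hQP, Matrix.zero_mulVec]
    convert F.pullVec_mem_pullback f (hW.trans e) _ h2 using 1
    funext j
    simp [pullVec, Matrix.transpose_apply]

theorem IsKerOn.pullback_of_normalized {F : Subbundle S n r} {U : S.Opens}
    {Q : Matrix (Fin q) (Fin n) Γ(S, U)} (hF : F.IsKerOn U Q) (c : Fin r ⊕ Fin q ≃ Fin n)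
    (hQ : Q * inrMatrix c Γ(S, U) = 1) (f : T ⟶ S) (V : T.Opens) (e : V ≤ f ⁻¹ᵁ U) :
    (F.pullback f).IsKerOn V (Q.map (f.appLE U V e).hom) :=
  hF.pullback (1 - inrMatrix c Γ(S, U) * Q) (inrMatrix c Γ(S, U))
    (by rw [Matrix.mul_sub, ← Matrix.mul_assoc, hQ, Matrix.one_mul, Matrix.mul_one, sub_self])
    (sub_add_cancel _ _) f V e

/-- The image of a split injection B is the kernel of 1 - B C with complementary projector B C, so
the kernel case applies. -/
theorem IsRangeOn.pullback {F : Subbundle S n r} {U : S.Opens} {B : Matrix (Fin n) (Fin r) Γ(S, U)}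
    (hF : F.IsRangeOn U B) (C : Matrix (Fin r) (Fin n) Γ(S, U)) (hCB : C * B = 1) (f : T ⟶ S)
    (V : T.Opens) (e : V ≤ f ⁻¹ᵁ U) :
    (F.pullback f).IsRangeOn V (B.map (f.appLE U V e).hom) := by
  have key : ∀ {A : CommRingCat.{u}} (B : Matrix (Fin n) (Fin r) A) (C : Matrix (Fin r) (Fin n) A)
      (_ : C * B = 1) (s : Fin n → A), s ∈ LinearMap.range B.mulVecLin ↔ (1 - B * C).mulVec s = 0 := by
    intro A B C hCB s
    constructor
    · rintro ⟨c, rfl⟩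
      rw [Matrix.mulVecLin_apply, Matrix.mulVec_mulVec, Matrix.sub_mul, Matrix.one_mul,
        Matrix.mul_assoc, hCB, Matrix.mul_one, sub_self, Matrix.zero_mulVec]
    · intro hs
      rw [Matrix.sub_mulVec, Matrix.one_mulVec, sub_eq_zero, ← Matrix.mulVec_mulVec] at hs
      exact ⟨_, hs.symm⟩
  have hK : F.IsKerOn U (1 - B * C) := by
    intro W hW s
    rw [hF W hW, resMat_sub, resMat_one, resMat_mul]
    exact key _ _ (by rw [← resMat_mul, hCB, resMat_one]) s
  have hKf := hK.pullback (B * C) 1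
    (by rw [Matrix.sub_mul, Matrix.one_mul, Matrix.mul_assoc, ← Matrix.mul_assoc C, hCB,
      Matrix.one_mul, sub_self]) (by rw [Matrix.one_mul, add_sub_cancel]) f V e
  intro W hW
  ext s
  rw [hKf W hW, key _ (resMat hW (C.map (f.appLE U V e).hom))]
  · rw [← resMat_mul, ← Matrix.map_mul, ← resMat_one hW, ← resMat_sub,
      Matrix.map_sub _ (map_sub (f.appLE U V e).hom),
      Matrix.map_one _ (map_zero (f.appLE U V e).hom) (map_one _)]
  · rw [← resMat_mul, ← Matrix.map_mul, hCB, Matrix.map_one _ (map_zero _) (map_one _), resMat_one]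

/-- One inclusion holds because the minor of the pulled back frame is the pullback of the minor. The
other pulls back a normalized matrix. -/
theorem generatedLocus_pullback (F : Subbundle S n r) (c : Fin r ⊕ Fin q ≃ Fin n) (f : T ⟶ S) :
    (F.pullback f).generatedLocus (Set.range (c ∘ Sum.inr)) =
      f ⁻¹ᵁ F.generatedLocus (Set.range (c ∘ Sum.inr)) := by
  ext x
  constructor
  · intro hx
    obtain ⟨U, hxU, B, C, hCB, hB⟩ := F.locally_split (f x)
    have hB' : F.IsRangeOn U B := hB
    have h1 := (hB'.pullback C hCB f (f ⁻¹ᵁ U) le_rfl).mem_basicOpen c hxU hx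
    have h2 : ((inlMatrix c Γ(T, f ⁻¹ᵁ U)).transpose * B.map (f.appLE U (f ⁻¹ᵁ U) le_rfl).hom).det =
        (f.app U).hom ((inlMatrix c Γ(S, U)).transpose * B).det := by
      rw [RingHom.map_det, RingHom.mapMatrix_apply, Matrix.map_mul, Matrix.transpose_map,
        inlMatrix_map, Scheme.Hom.appLE_eq_app]
    rw [h2] at h1
    have h3 := Scheme.preimage_basicOpen f ((inlMatrix c Γ(S, U)).transpose * B).det
    have h4 : x ∈ f ⁻¹ᵁ S.basicOpen ((inlMatrix c Γ(S, U)).transpose * B).det := h3 ▸ h1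
    obtain ⟨V, Q, hxV, hQ, hV⟩ := hB'.exists_isKerOn c h4
    exact hV.le_generatedLocus c hQ hxV
  · intro hx
    obtain ⟨V, Q, hxV, hQ, hV⟩ := F.exists_isKerOn_of_mem_generatedLocus c hx
    refine (hV.pullback_of_normalized c hQ f (f ⁻¹ᵁ V) le_rfl).le_generatedLocus c ?_ hxV
    rw [← inrMatrix_map c (f.appLE V (f ⁻¹ᵁ V) le_rfl).hom, ← Matrix.map_mul, hQ,
      Matrix.map_one _ (map_zero _) (map_one _)]

end Subbundle

end Loci

/-! ### Charts -/

section Charts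

variable {O : Type u} [CommRing O] {m n r q : ℕ}

/-- The open subset where for all `i` the quotient by `F_i` is generated by the basis vectors in
the second block of the decomposition `c_i`. -/
def chartLocus {S : Scheme.{u}} (c : Fin m → Fin r ⊕ Fin q ≃ Fin n)
    (F : Fin m → Subbundle S n r) : S.Opens where
  carrier := {x | ∀ i, x ∈ (F i).generatedLocus (Set.range (c i ∘ Sum.inr))}
  is_open' := by
    rw [Set.ofPred_forall]
    exact isOpen_iInter_of_finite fun i => ((F i).generatedLocus _).isOpen

theorem chartLocus_pullback {S T : Scheme.{u}} (c : Fin m → Fin r ⊕ Fin q ≃ Fin n)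
    (F : Fin m → Subbundle S n r) (f : T ⟶ S) :
    chartLocus c (fun i => (F i).pullback f) = f ⁻¹ᵁ chartLocus c F := by
  ext x
  change (∀ i, x ∈ ((F i).pullback f).generatedLocus _) ↔
    ∀ i, f x ∈ (F i).generatedLocus (Set.range (c i ∘ Sum.inr))
  refine forall_congr' fun i => ?_
  rw [Subbundle.generatedLocus_pullback]
  rfl

theorem exists_mem_chartLocus {S : Scheme.{u}} (hn : n = r + q) (F : Fin m → Subbundle S n r)
    (x : S) : ∃ c : Fin m → Fin r ⊕ Fin q ≃ Fin n, x ∈ chartLocus c F := by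
  choose c hc using fun i => (F i).exists_mem_generatedLocus hn x
  exact ⟨c, hc⟩

/-- Matrices over the `O`-algebra `A`, normalized with respect to `c`, whose kernels are mapped into
each other by the `φ_i`. -/
structure IsChartDatum {A : Type*} [CommRing A] (α : O →+* A)
    (φ : Fin m → Matrix (Fin n) (Fin n) O) (c : Fin m → Fin r ⊕ Fin q ≃ Fin n)
    (Q : Fin m → Matrix (Fin q) (Fin n) A) : Prop where
  normalized : ∀ i, Q i * inrMatrix (c i) A = 1
  compat : ∀ i, Q (next i) * (φ i).map α * (1 - inrMatrix (c i) A * Q i) = 0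

variable {φ : Fin m → Matrix (Fin n) (Fin n) O} {c : Fin m → Fin r ⊕ Fin q ≃ Fin n}

theorem IsChartDatum.map {A A' : Type*} [CommRing A] [CommRing A'] {α : O →+* A} {α' : O →+* A'}
    {Q : Fin m → Matrix (Fin q) (Fin n) A} (h : IsChartDatum α φ c Q) (f : A →+* A')
    (hf : f.comp α = α') : IsChartDatum α' φ c (fun i => (Q i).map f) where
  normalized i := by
    rw [← inrMatrix_map (c i) f, ← Matrix.map_mul, h.normalized,
      Matrix.map_one _ (map_zero f) (map_one f)]
  compat i := by
    have h1 := congrArg (fun M => M.map f) (h.compat i)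
    simp only [Matrix.map_mul, Matrix.map_sub _ (map_sub f), Matrix.map_one _ (map_zero f) (map_one f),
      inrMatrix_map, Matrix.map_zero _ (map_zero f), Matrix.map_map] at h1
    rw [← hf, RingHom.coe_comp]
    exact h1

theorem resMat_structMap {k l : ℕ} (S : Over (Spec (CommRingCat.of O))) {U V : S.left.Opens}
    (h : V ≤ U) (M : Matrix (Fin k) (Fin l) O) :
    resMat h (M.map (structMap S U)) = M.map (structMap S V) := by
  ext a b
  simp only [resMat, Matrix.map_apply]
  have h2 := appLE_structMap (𝟙 S) U V h (M a b)
  rw [← h2]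
  simp only [Over.id_left, Scheme.Hom.appLE, Scheme.Hom.id_app]
  rfl

/-- The columns of 1 - ι Q_i are sections of F_i, so φ_i carries them into ker Q_{i+1}. -/
theorem compat_of_isKerOn {S : Over (Spec (CommRingCat.of O))} {F : CompatibleFamily φ r S}
    {Q : Fin m → Matrix (Fin q) (Fin n) Γ(S.left, ⊤)}
    (hF : ∀ i, (F.sub i).IsKerOn ⊤ (Q i)) (hQ : ∀ i, Q i * inrMatrix (c i) Γ(S.left, ⊤) = 1) :
    IsChartDatum (structMap S ⊤) φ c Q where
  normalized := hQ
  compat i := by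
    apply Matrix.ext_of_mulVec_single
    intro j
    rw [Matrix.mul_assoc, ← Matrix.mulVec_mulVec, ← Matrix.mulVec_mulVec, Matrix.zero_mulVec]
    have h1 := hF (next i) ⊤ le_rfl (((φ i).map (structMap S ⊤)).mulVec
      ((1 - inrMatrix (c i) Γ(S.left, ⊤) * Q i).mulVec (Pi.single j 1)))
    rw [resMat_self] at h1
    rw [← h1]
    refine F.compat i ⊤ _ ?_
    rw [hF i ⊤ le_rfl, resMat_self, Matrix.mulVec_mulVec, Matrix.mul_sub, ← Matrix.mul_assoc,
      hQ, Matrix.one_mul, Matrix.mul_one, sub_self, Matrix.zero_mulVec]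

/-- The family of the kernels of the matrices of a chart datum. -/
def chartFamily (S : Over (Spec (CommRingCat.of O))) (Q : Fin m → Matrix (Fin q) (Fin n) Γ(S.left, ⊤))
    (hQ : IsChartDatum (structMap S ⊤) φ c Q) : CompatibleFamily φ r S where
  sub i := Subbundle.ofKer (c i) (Q i) (hQ.normalized i)
  compat i U s hs := by
    rw [Subbundle.isKerOn_ofKer _ _ _ U le_top] at hs ⊢
    have h1 := congrArg (fun M => (resMat (le_top : U ≤ ⊤) M).mulVec s) (hQ.compat i)
    simp only [resMat_mul, resMat_sub, resMat_one, resMat_zero,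
      resMat_structMap, ← Matrix.mulVec_mulVec, Matrix.sub_mulVec, Matrix.one_mulVec, hs,
      Matrix.mulVec_zero, sub_zero, Matrix.zero_mulVec] at h1
    exact h1

theorem isKerOn_chartFamily (S : Over (Spec (CommRingCat.of O)))
    (Q : Fin m → Matrix (Fin q) (Fin n) Γ(S.left, ⊤))
    (hQ : IsChartDatum (structMap S ⊤) φ c Q) (i : Fin m) :
    ((chartFamily S Q hQ).sub i).IsKerOn ⊤ (Q i) :=
  Subbundle.isKerOn_ofKer (c i) (Q i) (hQ.normalized i)

theorem eq_chartFamily {S : Over (Spec (CommRingCat.of O))} {F : CompatibleFamily φ r S}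
    {Q : Fin m → Matrix (Fin q) (Fin n) Γ(S.left, ⊤)}
    (hQ : IsChartDatum (structMap S ⊤) φ c Q) (hF : ∀ i, (F.sub i).IsKerOn ⊤ (Q i)) :
    F = chartFamily S Q hQ :=
  CompatibleFamily.ext (funext fun i => Subbundle.eq_of_isKerOn (hF i) (isKerOn_chartFamily S Q hQ i))

theorem chartLocus_chartFamily (S : Over (Spec (CommRingCat.of O)))
    (Q : Fin m → Matrix (Fin q) (Fin n) Γ(S.left, ⊤))
    (hQ : IsChartDatum (structMap S ⊤) φ c Q) :
    chartLocus c (chartFamily S Q hQ).sub = ⊤ :=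
  eq_top_iff.mpr fun _ hx i =>
    (isKerOn_chartFamily S Q hQ i).le_generatedLocus (c i) (hQ.normalized i) hx

theorem chartFamily_injective {S : Over (Spec (CommRingCat.of O))}
    {Q Q' : Fin m → Matrix (Fin q) (Fin n) Γ(S.left, ⊤)}
    {hQ : IsChartDatum (structMap S ⊤) φ c Q} {hQ' : IsChartDatum (structMap S ⊤) φ c Q'}
    (h : chartFamily S Q hQ = chartFamily S Q' hQ') : Q = Q' := by
  funext i
  refine Subbundle.IsKerOn.eq (c i) (isKerOn_chartFamily S Q hQ i) ?_ (hQ.normalized i)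
    (hQ'.normalized i)
  rw [h]
  exact isKerOn_chartFamily S Q' hQ' i

/-- Together with `chartFamily_injective`, this turns families in the chart over any scheme, affine
or not, into chart data over the ring of global functions. -/
theorem exists_eq_chartFamily {S : Over (Spec (CommRingCat.of O))} (F : CompatibleFamily φ r S)
    (hF : chartLocus c F.sub = ⊤) :
    ∃ (Q : Fin m → Matrix (Fin q) (Fin n) Γ(S.left, ⊤))
      (hQ : IsChartDatum (structMap S ⊤) φ c Q), F = chartFamily S Q hQ := by
  choose Q hQ hFQ using fun i => (F.sub i).exists_isKerOn_top (c i) fun x => by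
    have : x ∈ chartLocus c F.sub := hF ▸ trivial
    exact this i
  exact ⟨Q, compat_of_isKerOn hFQ hQ, eq_chartFamily _ hFQ⟩

theorem appLE_top_comp_structMap {S T : Over (Spec (CommRingCat.of O))} (f : T ⟶ S) :
    (f.left.appLE ⊤ ⊤ le_top).hom.comp (structMap S ⊤) = structMap T ⊤ :=
  RingHom.ext fun a => appLE_structMap f ⊤ ⊤ le_top a

theorem chartFamily_pullback {S T : Over (Spec (CommRingCat.of O))}
    (Q : Fin m → Matrix (Fin q) (Fin n) Γ(S.left, ⊤))
    (hQ : IsChartDatum (structMap S ⊤) φ c Q) (f : T ⟶ S) :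
    (chartFamily S Q hQ).pullback f =
      chartFamily T (fun i => (Q i).map (f.left.appLE ⊤ ⊤ le_top).hom)
        (hQ.map _ (appLE_top_comp_structMap f)) :=
  eq_chartFamily _ fun i =>
    (isKerOn_chartFamily S Q hQ i).pullback_of_normalized (c i) (hQ.normalized i) f.left ⊤ le_top

/-- The family `ξ` over `Y` is universal among the families in the chart `c`. -/
structure IsChart (c : Fin m → Fin r ⊕ Fin q ≃ Fin n) {Y : Over (Spec (CommRingCat.of O))}
    (ξ : CompatibleFamily φ r Y) : Prop where
  locus : chartLocus c ξ.sub = ⊤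
  existsUnique : ∀ {T : Over (Spec (CommRingCat.of O))} (F : CompatibleFamily φ r T),
    chartLocus c F.sub = ⊤ → ∃! f : T ⟶ Y, ξ.pullback f = F

/-- A chart datum over the `O`-algebra `R` from which all others arise by base change. -/
structure IsUniversalDatum {R : Type u} [CommRing R] (ρ : O →+* R)
    (φ : Fin m → Matrix (Fin n) (Fin n) O) (c : Fin m → Fin r ⊕ Fin q ≃ Fin n)
    (Q : Fin m → Matrix (Fin q) (Fin n) R) : Prop where
  isChartDatum : IsChartDatum ρ φ c Q
  existsUnique : ∀ {A : Type u} [CommRing A] (α : O →+* A) (Q' : Fin m → Matrix (Fin q) (Fin n) A),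
    IsChartDatum α φ c Q' → ∃! g : R →+* A, g.comp ρ = α ∧ ∀ i, (Q i).map g = Q' i

theorem structMap_spec {R : Type u} [CommRing R] (ρ : O →+* R) :
    (Scheme.ΓSpecIso (CommRingCat.of R)).inv.hom.comp ρ =
      structMap (Over.mk (Spec.map (CommRingCat.ofHom ρ))) ⊤ := by
  have h := Scheme.ΓSpecIso_inv_naturality (CommRingCat.ofHom ρ)
  ext a
  have h1 := congrArg (fun f => f.hom a) h
  simp only [structMap]
  exact h1

/-- Families in the chart over T are chart data over Γ(T, ⊤), and morphisms T → Spec R are ring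
homomorphisms R → Γ(T, ⊤). -/
theorem IsUniversalDatum.isChart {R : Type u} [CommRing R] {ρ : O →+* R}
    {Q : Fin m → Matrix (Fin q) (Fin n) R} (h : IsUniversalDatum ρ φ c Q) :
    IsChart c (chartFamily (Over.mk (Spec.map (CommRingCat.ofHom ρ)))
      (fun i => (Q i).map (Scheme.ΓSpecIso (CommRingCat.of R)).inv.hom)
      (h.isChartDatum.map _ (structMap_spec ρ))) where
  locus := chartLocus_chartFamily _ _ _
  existsUnique {T} F hF := by
    obtain ⟨Q', hQ', rfl⟩ := exists_eq_chartFamily F hF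
    obtain ⟨g, ⟨hgρ, hgQ⟩, hguniq⟩ := h.existsUnique _ Q' hQ'
    have hle : ∀ f : T.left ⟶ Spec (CommRingCat.of R), f.appLE ⊤ ⊤ le_top = f.appTop := by
      intro f
      exact f.appLE_eq_app
    have hstr : (Scheme.ΓSpecIso (CommRingCat.of O)).inv ≫ T.hom.appTop =
        CommRingCat.ofHom (structMap T ⊤) := by
      ext a
      simp only [structMap, ← Scheme.Hom.appLE_eq_app]
      rfl
    have happ : (T.left.toSpecΓ ≫ Spec.map (CommRingCat.ofHom g)).appTop =
        (Scheme.ΓSpecIso (CommRingCat.of R)).hom ≫ CommRingCat.ofHom g := by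
      rw [Scheme.Hom.comp_appTop, Scheme.toSpecΓ_appTop, Scheme.ΓSpecIso_naturality]
    have hover : (T.left.toSpecΓ ≫ Spec.map (CommRingCat.ofHom g)) ≫
        Spec.map (CommRingCat.ofHom ρ) = T.hom := by
      apply ext_of_isAffine
      rw [← cancel_epi (Scheme.ΓSpecIso (CommRingCat.of O)).inv, hstr, Scheme.Hom.comp_appTop, happ,
        ← Scheme.ΓSpecIso_inv_naturality_assoc, Iso.inv_hom_id_assoc, ← CommRingCat.ofHom_comp, hgρ]
    let f : T ⟶ Over.mk (Spec.map (CommRingCat.ofHom ρ)) := Over.homMk _ hover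
    refine ⟨f, ?_, ?_⟩
    · change CompatibleFamily.pullback _ _ = _
      rw [chartFamily_pullback]
      congr 1
      funext i
      rw [Matrix.map_map, ← hgQ i]
      congr 1
      funext a
      change (f.left.appLE ⊤ ⊤ le_top).hom _ = _
      have : f.left.appLE ⊤ ⊤ le_top = _ := (hle f.left).trans happ
      rw [this]
      simp
    · intro f' hf'
      have hf'' : CompatibleFamily.pullback _ f' = _ := hf'
      rw [chartFamily_pullback] at hf''
      have hQQ := chartFamily_injective hf''
      have hg' := hguniq ((f'.left.appLE ⊤ ⊤ le_top).hom.comp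
        (Scheme.ΓSpecIso (CommRingCat.of R)).inv.hom) ⟨?_, ?_⟩
      · apply Over.OverMorphism.ext
        refine ext_of_isAffine (Y := Spec (CommRingCat.of R)) ?_
        rw [← cancel_epi (Scheme.ΓSpecIso (CommRingCat.of R)).inv]
        refine Eq.trans ?_ (congrArg (fun t => (Scheme.ΓSpecIso (CommRingCat.of R)).inv ≫ t) happ).symm
        rw [Iso.inv_hom_id_assoc]
        ext a
        have h3 := congrArg (fun t => t a) hg'
        have h4 := hle f'.left
        simp only [RingHom.comp_apply] at h3
        rw [← h4]
        exact h3
      · rw [RingHom.comp_assoc, structMap_spec]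
        exact appLE_top_comp_structMap f'
      · intro i
        rw [← congrFun hQQ i, Matrix.map_map]
        rfl

end Charts

/-! ### The coordinate rings of the charts -/

section Universal

variable {O : Type u} [CommRing O] {m n r q : ℕ}

/-- Generic matrices, modulo the entries of the two equations of a chart datum. -/
theorem exists_isUniversalDatum (φ : Fin m → Matrix (Fin n) (Fin n) O)
    (c : Fin m → Fin r ⊕ Fin q ≃ Fin n) :
    ∃ (R : Type u) (_ : CommRing R) (ρ : O →+* R) (Q : Fin m → Matrix (Fin q) (Fin n) R),
      IsUniversalDatum ρ φ c Q := by
  let P := MvPolynomial (Fin m × Fin q × Fin n) O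
  let X : Fin m → Matrix (Fin q) (Fin n) P := fun i => Matrix.of fun a b => MvPolynomial.X (i, a, b)
  let E₁ : Fin m → Matrix (Fin q) (Fin q) P := fun i => X i * inrMatrix (c i) P - 1
  let E₂ : Fin m → Matrix (Fin q) (Fin n) P := fun i =>
    X (next i) * (φ i).map (algebraMap O P) * (1 - inrMatrix (c i) P * X i)
  let I : Ideal P := Ideal.span ({p | ∃ i a b, p = E₁ i a b} ∪ {p | ∃ i a b, p = E₂ i a b})
  let mk : P →+* P ⧸ I := Ideal.Quotient.mk I
  have h₁ : ∀ i, (E₁ i).map mk = 0 := by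
    intro i
    ext a b
    exact Ideal.Quotient.eq_zero_iff_mem.mpr (Ideal.subset_span (Or.inl ⟨i, a, b, rfl⟩))
  have h₂ : ∀ i, (E₂ i).map mk = 0 := by
    intro i
    ext a b
    exact Ideal.Quotient.eq_zero_iff_mem.mpr (Ideal.subset_span (Or.inr ⟨i, a, b, rfl⟩))
  have e₁ : ∀ {A : Type u} [CommRing A] (g : P →+* A) (i : Fin m),
      (E₁ i).map g = (X i).map g * inrMatrix (c i) A - 1 := by
    intro A _ g i
    simp only [E₁, Matrix.map_sub _ (map_sub g), Matrix.map_mul, inrMatrix_map,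
      Matrix.map_one _ (map_zero g) (map_one g)]
  have e₂ : ∀ {A : Type u} [CommRing A] (g : P →+* A) (i : Fin m),
      (E₂ i).map g = (X (next i)).map g * (φ i).map (g.comp (algebraMap O P)) *
        (1 - inrMatrix (c i) A * (X i).map g) := by
    intro A _ g i
    simp only [E₂, Matrix.map_sub _ (map_sub g), Matrix.map_mul, inrMatrix_map,
      Matrix.map_one _ (map_zero g) (map_one g), Matrix.map_map, RingHom.coe_comp]
  refine ⟨P ⧸ I, inferInstance, mk.comp (algebraMap O P), fun i => (X i).map mk, ⟨⟨?_, ?_⟩, ?_⟩⟩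
  · intro i
    rw [← sub_eq_zero, ← e₁, h₁]
  · intro i
    rw [← e₂, h₂]
  · intro A _ α Q' hQ'
    let g : P →+* A := MvPolynomial.eval₂Hom α fun x => Q' x.1 x.2.1 x.2.2
    have hgX : ∀ i, (X i).map g = Q' i := by
      intro i
      ext a b
      exact MvPolynomial.eval₂Hom_X' α _ (i, a, b)
    have hgα : g.comp (algebraMap O P) = α := by
      ext a
      simp [g, P, MvPolynomial.algebraMap_eq]
    have hI : ∀ p ∈ I, g p = 0 := by
      intro p hp
      have : I ≤ RingHom.ker g := by
        refine Ideal.span_le.mpr ?_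
        rintro _ (⟨i, a, b, rfl⟩ | ⟨i, a, b, rfl⟩)
        · have : (E₁ i).map g = 0 := by rw [e₁, hgX, hQ'.normalized, sub_self]
          exact congrFun (congrFun this a) b
        · have : (E₂ i).map g = 0 := by rw [e₂, hgX, hgX, hgα, hQ'.compat]
          exact congrFun (congrFun this a) b
      exact this hp
    refine ⟨Ideal.Quotient.lift I g hI, ⟨?_, ?_⟩, ?_⟩
    · rw [← RingHom.comp_assoc, Ideal.Quotient.lift_comp_mk, hgα]
    · intro i
      rw [Matrix.map_map, ← hgX]
      rfl
    · rintro g' ⟨hg'α, hg'X⟩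
      apply Ideal.Quotient.ringHom_ext
      rw [Ideal.Quotient.lift_comp_mk]
      apply MvPolynomial.ringHom_ext
      · intro a
        have := congrArg (fun t => t a) (hg'α.trans hgα.symm)
        simpa [MvPolynomial.algebraMap_eq, P] using! this
      · rintro ⟨i, a, b⟩
        have := congrFun (congrFun ((hg'X i).trans (hgX i).symm) a) b
        exact this

end Universal

/-! ### Cyclic products of companion matrices -/

section Companion

variable {A : Type*} [CommRing A] {n q : ℕ} [NeZero n]

theorem next_eq_add_one (i : Fin n) : next i = i + 1 := by
  ext
  simp [next, Fin.val_add]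

theorem val_one_eq_mod : (1 : Fin n).val = 1 % n := rfl

theorem val_neg_one_sub (x : Fin n) : (-1 - x).val = n - 1 - x.val := by
  have hx := x.2
  have h : -1 - x = ⟨n - 1 - x.val, by omega⟩ := by
    rw [sub_eq_iff_eq_add, neg_eq_iff_add_eq_zero]
    ext
    simp only [Fin.val_add, Fin.val_zero, val_one_eq_mod]
    rw [show n - 1 - x.val + x.val = n - 1 by omega, Nat.mod_add_mod, Nat.add_mod_mod,
      show 1 + (n - 1) = n by omega, Nat.mod_self]
  rw [h]

theorem val_sub_one_add_one {t : Fin n} (ht : t ≠ 0) : (t - 1).val + 1 = t.val := by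
  have h := val_neg_one_sub (-t)
  have h0 : (-t).val = n - t.val := by
    rw [Fin.val_neg, if_neg ht]
  have ht' : t.val ≠ 0 := fun h => ht (Fin.ext h)
  have := t.2
  rw [show -1 - -t = t - 1 by abel, h0] at h
  omega

/-- The matrix with first column `a`, entries `1` just above the diagonal and `0` elsewhere. -/
def companion (a : Fin q → A) : Matrix (Fin q) (Fin q) A :=
  Matrix.of fun μ ν => if ν.1 = 0 then a μ else if μ.1 + 1 = ν.1 then 1 else 0

theorem companion_map {A' : Type*} [CommRing A'] (a : Fin q → A) (f : A →+* A') :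
    (companion a).map f = companion (fun μ => f (a μ)) := by
  ext μ ν
  simp only [companion, Matrix.map_apply, Matrix.of_apply]
  split_ifs <;> simp

/-- The product `A_{i-1} A_{i-2} ⋯ A_{i-k}` of companion matrices. -/
def companionProd (a : Fin n → Fin q → A) : ℕ → Fin n → Matrix (Fin q) (Fin q) A
  | 0, _ => 1
  | k + 1, i => companion (a (i - 1)) * companionProd a k (i - 1)

/-- The vector `A_{i-1} A_{i-2} ⋯ A_{i-k} e`, where `e` is the last basis vector. -/
def companionVec (a : Fin n → Fin q → A) (k : ℕ) (i : Fin n) : Fin q → A :=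
  (companionProd a k i).mulVec fun κ => if κ.1 + 1 = q then 1 else 0

variable (a : Fin n → Fin q → A)

theorem companionVec_zero (i : Fin n) (κ : Fin q) :
    companionVec a 0 i κ = if κ.1 + 1 = q then 1 else 0 := by
  simp [companionVec, companionProd]

theorem companionVec_succ (k : ℕ) (i : Fin n) :
    companionVec a (k + 1) i = (companion (a (i - 1))).mulVec (companionVec a k (i - 1)) := by
  simp [companionVec, companionProd]

theorem companionVec_succ_add_one (k : ℕ) (i : Fin n) :
    companionVec a (k + 1) (i + 1) = (companion (a i)).mulVec (companionVec a k i) := by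
  rw [companionVec_succ, add_sub_cancel_right]

theorem companionVec_map {A' : Type*} [CommRing A'] (f : A →+* A') (k : ℕ) (i : Fin n) (κ : Fin q) :
    f (companionVec a k i κ) = companionVec (fun i μ => f (a i μ)) k i κ := by
  induction k generalizing i κ with
  | zero =>
    rw [companionVec_zero, companionVec_zero]
    split_ifs <;> simp
  | succ k ih =>
    rw [companionVec_succ, companionVec_succ, ← companion_map, RingHom.map_mulVec]
    congr 1
    funext κ
    exact ih _ κ

theorem companion_mulVec_single (b : Fin q → A) (ν : Fin q) (μ : Fin q) :
    (companion b).mulVec (Pi.single ν 1) μ =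
      if ν.1 = 0 then b μ else if μ.1 + 1 = ν.1 then 1 else 0 := by
  simp [companion]

/-- A companion matrix sends the ν-th basis vector to the (ν - 1)-st for ν > 0. Starting at the last
one, the first q - 1 steps do not involve the entries a. -/
theorem companionVec_eq_single (k : ℕ) (i : Fin n) (ν : Fin q) (hk : k + ν.1 + 1 = q) :
    companionVec a k i = Pi.single ν 1 := by
  induction k generalizing i ν with
  | zero =>
    funext κ
    rw [companionVec_zero, Pi.single_apply]
    congr 1
    rw [Fin.ext_iff]
    exact propext (by omega)
  | succ k ih =>
    funext μ
    rw [companionVec_succ, ih (i - 1) ⟨ν.1 + 1, by omega⟩ (by simp only; omega),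
      companion_mulVec_single, Pi.single_apply, if_neg (by simp)]
    congr 1
    rw [Fin.ext_iff]
    exact propext (by simp)

/-- After q - 1 steps the vector is the first basis vector, so the q-th step picks out the first
column. -/
theorem companionVec_card (hq : 0 < q) (i : Fin n) : companionVec a q (i + 1) = a i := by
  obtain ⟨k, rfl⟩ : ∃ k, q = k + 1 := ⟨q - 1, by omega⟩
  funext μ
  rw [companionVec_succ_add_one, companionVec_eq_single a k i 0 (by simp), companion_mulVec_single]
  simp

/-- Subtract `1` from `i` for `k` times. -/
def subOnes (i : Fin n) : ℕ → Fin n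
  | 0 => i
  | k + 1 => subOnes (i - 1) k

theorem val_subOnes (i : Fin n) (k : ℕ) : ((subOnes i k).val + k) % n = i.val := by
  induction k generalizing i with
  | zero => exact Nat.mod_eq_of_lt i.2
  | succ k ih =>
    rw [subOnes, ← add_assoc, ← Nat.mod_add_mod, ih, ← Nat.add_mod_mod]
    have : (i - 1 + 1).val = i.val := by rw [sub_add_cancel]
    rw [Fin.val_add, val_one_eq_mod] at this
    exact this

theorem subOnes_card (i : Fin n) : subOnes i n = i := by
  have h := val_subOnes i n
  rw [Nat.add_mod_right, Nat.mod_eq_of_lt (subOnes i n).2] at h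
  exact Fin.ext h

theorem companionVec_add (k j : ℕ) (i : Fin n) :
    companionVec a (k + j) i = (companionProd a k i).mulVec (companionVec a j (subOnes i k)) := by
  induction k generalizing i with
  | zero => simp [companionProd, subOnes]
  | succ k ih =>
    rw [Nat.add_right_comm, companionVec_succ, ih, companionProd, subOnes, Matrix.mulVec_mulVec]

/-- All the cyclic products are equal to the scalar `p` as soon as they have the right last
columns. -/
theorem companionProd_eq_scalar_iff (p : A) :
    (∀ i, companionProd a n i = Matrix.scalar (Fin q) p) ↔
      ∀ i κ, companionVec a n i κ = p * companionVec a 0 i κ := by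
  constructor
  · intro h i κ
    have h1 := companionVec_add a n 0 i
    rw [add_zero, h, subOnes_card] at h1
    rw [h1]
    simp [Matrix.mulVec_diagonal]
  · intro h i
    apply Matrix.ext_of_mulVec_single
    intro ν
    obtain ⟨k, hk⟩ : ∃ k, k + ν.1 + 1 = q := ⟨q - 1 - ν.1, by have := ν.2; omega⟩
    -- Every basis vector arises from the last one by k companion matrices, so the scalar identity
    -- may be tested on such products.
    rw [← companionVec_eq_single a k i ν hk]
    -- Splitting n + k factors in two ways moves the full cyclic product at i past the first k
    -- factors. It becomes the cyclic product at i - k, acting on the last basis vector.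
    have h1 := companionVec_add a n k i
    rw [subOnes_card, add_comm, companionVec_add] at h1
    rw [← h1]
    have h2 : companionVec a n (subOnes i k) = p • companionVec a 0 (subOnes i k) :=
      funext fun κ => h _ κ
    rw [h2, Matrix.mulVec_smul, ← companionVec_add, add_zero]
    funext κ
    simp [Matrix.mulVec_diagonal]

theorem companionProd_eq_prod (k : ℕ) (i : Fin n) :
    companionProd a k i = (List.ofFn fun l : Fin k => companion (a (subOnes i (l.1 + 1)))).prod := by
  induction k generalizing i with
  | zero => simp [companionProd]
  | succ k ih =>
    rw [companionProd, ih, List.ofFn_succ, List.prod_cons]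
    rfl

theorem companionProd_map {A' : Type*} [CommRing A'] (f : A →+* A') (k : ℕ) (i : Fin n) :
    (companionProd a k i).map f = companionProd (fun i μ => f (a i μ)) k i := by
  induction k generalizing i with
  | zero => exact Matrix.map_one _ (map_zero f) (map_one f)
  | succ k ih => rw [companionProd, companionProd, Matrix.map_mul, ih, companion_map]

theorem cyclicProduct_eq (O : Type u) [CommRing O] (r : ℕ) (k : Fin n) :
    cyclicProduct O n r k =
      companionProd (fun i κ => (MvPolynomial.X (i, κ) : PolyRing O n r)) n k := by
  rw [companionProd_eq_prod, cyclicProduct]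
  congr 2
  funext l
  have : (⟨(k.1 + (n - 1 - l.1)) % n, Nat.mod_lt _ k.pos⟩ : Fin n) = subOnes k (l.1 + 1) := by
    ext
    have h := val_subOnes k (l.1 + 1)
    have hl := l.2
    have h2 := (subOnes k (l.1 + 1)).2
    simp only
    rw [← h, Nat.mod_add_mod, show (subOnes k (l.1 + 1)).val + (l.1 + 1) + (n - 1 - l.1) =
      (subOnes k (l.1 + 1)).val + n by omega, Nat.add_mod_right, Nat.mod_eq_of_lt h2]
  rw [this]
  rfl

end Companion

/-! ### The chart of the alcove `τ` -/

section TauChart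

variable {O : Type u} [CommRing O] {n r q : ℕ} {A : Type*} [CommRing A]

/-- The matrices of the cyclic chain, `π` standing at the `i`-th place of the `i`-th matrix. -/
def shiftMatrix (π : O) (i : Fin n) : Matrix (Fin n) (Fin n) O :=
  Matrix.diagonal fun j => if j = i then π else 1

theorem mul_shiftMatrix_map (π : O) (α : O →+* A) (i : Fin n) (Q : Matrix (Fin q) (Fin n) A)
    (κ : Fin q) (j : Fin n) :
    (Q * (shiftMatrix π i).map α) κ j = Q κ j * if j = i then α π else 1 := by
  rw [shiftMatrix, Matrix.diagonal_map (map_zero α), Matrix.mul_diagonal]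
  simp only [apply_ite α, map_one]

variable [NeZero n]

/-- The decomposition of the indices into the cyclic intervals `i, …, i + r - 1` and
`i + r, …, i + n - 1`. -/
def tauEquiv (hn : r + q = n) (i : Fin n) : Fin r ⊕ Fin q ≃ Fin n :=
  (finSumFinEquiv.trans (finCongr hn)).trans (Equiv.addLeft i)

theorem tauEquiv_inl (hn : r + q = n) (i : Fin n) (l : Fin r) :
    tauEquiv hn i (Sum.inl l) = i + ⟨l.1, by omega⟩ := rfl

theorem tauEquiv_inr (hn : r + q = n) (i : Fin n) (κ : Fin q) :
    tauEquiv hn i (Sum.inr κ) = i + ⟨r + κ.1, by omega⟩ := rfl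

/-- The chart datum belonging to a tuple of companion matrices. -/
def tauDatum (a : Fin n → Fin q → A) (i : Fin n) : Matrix (Fin q) (Fin n) A :=
  Matrix.of fun κ j => companionVec a (i - 1 - j).val i κ

theorem tauDatum_inr (hn : r + q = n) (a : Fin n → Fin q → A) (i : Fin n) (κ ν : Fin q) :
    tauDatum a i κ (tauEquiv hn i (Sum.inr ν)) = if κ = ν then 1 else 0 := by
  rw [tauEquiv_inr, tauDatum, Matrix.of_apply,
    show i - 1 - (i + ⟨r + ν.1, by omega⟩) = -1 - (⟨r + ν.1, by omega⟩ : Fin n) by abel,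
    val_neg_one_sub, companionVec_eq_single a _ i ν (by have := ν.2; simp only; omega),
    Pi.single_apply]

/-- The coordinates a^i are entries of the chart datum: the cyclic distance from i + r to i is -r,
that is q modulo n. For r = 0 it would be 0 instead. -/
theorem tauDatum_add_one (hr : 0 < r) (hq : 0 < q) (hn : r + q = n) (a : Fin n → Fin q → A)
    (i : Fin n) (κ : Fin q) : tauDatum a (i + 1) κ (i + ⟨r, by omega⟩) = a i κ := by
  have h : (i + 1 - 1 - (i + ⟨r, by omega⟩) : Fin n).val = q := by
    rw [show i + 1 - 1 - (i + ⟨r, by omega⟩) = -1 - (⟨r - 1, by omega⟩ : Fin n) by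
      rw [show (⟨r, by omega⟩ : Fin n) = ⟨r - 1, by omega⟩ + 1 from ?_]
      · abel
      · ext
        rw [Fin.val_add, val_one_eq_mod, Nat.add_mod_mod]
        simp only
        rw [Nat.sub_add_cancel hr, Nat.mod_eq_of_lt (by omega)], val_neg_one_sub]
    simp only
    omega
  rw [tauDatum, Matrix.of_apply, h, companionVec_card a hq]

theorem tauDatum_map {A' : Type*} [CommRing A'] (a : Fin n → Fin q → A) (f : A →+* A') (i : Fin n) :
    (tauDatum a i).map f = tauDatum (fun i κ => f (a i κ)) i := by
  ext κ j
  exact companionVec_map a f _ i κ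

theorem isChartDatum_tauDatum {π : O} {α : O →+* A} (hn : r + q = n) (a : Fin n → Fin q → A)
    (ha : ∀ i κ, companionVec a n i κ = α π * companionVec a 0 i κ) :
    IsChartDatum α (shiftMatrix π) (tauEquiv hn) (tauDatum a) := by
  have hnorm : ∀ i, tauDatum a i * inrMatrix (tauEquiv hn i) A = 1 := by
    intro i
    ext κ ν
    rw [mul_inrMatrix, Matrix.one_apply]
    exact tauDatum_inr hn a i κ ν
  refine ⟨hnorm, fun i => ?_⟩
  have hstep : tauDatum a (next i) * (shiftMatrix π i).map α = companion (a i) * tauDatum a i := by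
    ext κ j
    rw [mul_shiftMatrix_map, next_eq_add_one]
    have h1 : (companion (a i) * tauDatum a i) κ j =
        companionVec a ((i - 1 - j).val + 1) (i + 1) κ := by
      rw [companionVec_succ_add_one]
      rfl
    rw [h1, tauDatum, Matrix.of_apply, add_sub_cancel_right]
    -- For j ≠ i passing to i + 1 increases the distance by one. For j = i the distance n - 1 wraps
    -- around to 0, and the hypothesis on the n-fold product supplies the factor π.
    by_cases hj : j = i
    · subst hj
      have h2 := val_neg_one_sub (0 : Fin n)
      have h3 := j.pos
      rw [if_pos rfl, sub_self, show j - 1 - j = -1 - 0 by abel, h2, Fin.val_zero, tsub_zero,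
        Nat.sub_add_cancel h3, ha, mul_comm]
    · have h2 : i - j ≠ 0 := fun h => hj (sub_eq_zero.mp h).symm
      rw [if_neg hj, mul_one, show i - 1 - j = i - j - 1 by abel, val_sub_one_add_one h2]
  rw [hstep, Matrix.mul_assoc, Matrix.mul_sub (tauDatum a i), ← Matrix.mul_assoc (tauDatum a i),
    hnorm, Matrix.one_mul, Matrix.mul_one, sub_self, Matrix.mul_zero]

/-- The first columns of the matrices which a chart datum induces on the quotients. -/
def firstColumns (hq : 0 < q) (hn : r + q = n) (Q : Fin n → Matrix (Fin q) (Fin n) A) (i : Fin n)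
    (κ : Fin q) : A :=
  Q (i + 1) κ (i + ⟨r, by omega⟩)

/-- Compatibility means that Q_{i+1} φ_i factors through Q_i; the factor is its restriction to the
second block. All columns there except the first are columns of the identity block of Q_{i+1},
shifted by one. -/
theorem IsChartDatum.step {π : O} {α : O →+* A} (hr : 0 < r) (hq : 0 < q) (hn : r + q = n)
    {Q : Fin n → Matrix (Fin q) (Fin n) A} (hQ : IsChartDatum α (shiftMatrix π) (tauEquiv hn) Q)
    (i : Fin n) :
    Q (i + 1) * (shiftMatrix π i).map α = companion (firstColumns hq hn Q i) * Q i := by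
  have h1 := hQ.compat i
  rw [Matrix.mul_sub, Matrix.mul_one, sub_eq_zero, ← Matrix.mul_assoc, next_eq_add_one] at h1
  have h2 : Q (i + 1) * (shiftMatrix π i).map α * inrMatrix (tauEquiv hn i) A =
      companion (firstColumns hq hn Q i) := by
    ext κ ν
    rw [mul_inrMatrix, Matrix.submatrix_apply, id, mul_shiftMatrix_map, Function.comp_apply,
      tauEquiv_inr, if_neg, mul_one, companion, Matrix.of_apply]
    · by_cases hν : ν.1 = 0
      · rw [if_pos hν, firstColumns]
        simp only [hν, add_zero]
      · rw [if_neg hν]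
        have h3 := congrFun (congrFun (hQ.normalized (i + 1)) κ) ⟨ν.1 - 1, by omega⟩
        rw [mul_inrMatrix, Matrix.submatrix_apply, id, Function.comp_apply, tauEquiv_inr,
          Matrix.one_apply] at h3
        have h4 : i + 1 + (⟨r + (ν.1 - 1), by omega⟩ : Fin n) = i + ⟨r + ν.1, by omega⟩ := by
          rw [add_assoc]
          congr 1
          ext
          rw [Fin.val_add, val_one_eq_mod, Nat.mod_add_mod]
          simp only
          rw [Nat.mod_eq_of_lt (by omega)]
          omega
        rw [← h4, h3]
        exact if_congr (by simp only [Fin.ext_iff]; omega) rfl rfl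
    -- The entry π stands at i, which is outside the second block since r > 0.
    · rw [add_eq_left, Fin.ext_iff]
      simp only [Fin.val_zero]
      omega
  rw [h1, h2]

/-- Induction on the cyclic distance k from j to i - 1. At distance 0 the column is the last one of
the identity block, and away from the entry π each step multiplies by one companion matrix. -/
theorem IsChartDatum.eq_companionVec {π : O} {α : O →+* A} (hr : 0 < r) (hq : 0 < q)
    (hn : r + q = n) {Q : Fin n → Matrix (Fin q) (Fin n) A}
    (hQ : IsChartDatum α (shiftMatrix π) (tauEquiv hn) Q) (k : ℕ) (i j : Fin n)
    (hk : (i - 1 - j).val = k) (κ : Fin q) :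
    Q i κ j = companionVec (firstColumns hq hn Q) k i κ := by
  induction k generalizing i j κ with
  | zero =>
    have h1 : i - 1 - j = 0 := Fin.ext hk
    have h2 := congrFun (congrFun (hQ.normalized i) κ) ⟨q - 1, by omega⟩
    rw [mul_inrMatrix, Matrix.submatrix_apply, id, Function.comp_apply, tauEquiv_inr,
      Matrix.one_apply] at h2
    have h3 : i + (⟨r + (q - 1), by omega⟩ : Fin n) = j := by
      rw [← sub_eq_zero.mp h1, sub_eq_add_neg]
      congr 1
      rw [← sub_zero (-1 : Fin n)]
      ext
      rw [val_neg_one_sub]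
      simp only [Fin.val_zero]
      omega
    rw [companionVec_zero, ← h3, h2]
    exact if_congr (by simp only [Fin.ext_iff]; omega) rfl rfl
  | succ k ih =>
    obtain ⟨i, rfl⟩ : ∃ i', i = i' + 1 := ⟨i - 1, by rw [sub_add_cancel]⟩
    rw [add_sub_cancel_right] at hk
    have hne : i - j ≠ 0 := fun h => by rw [h] at hk; simp at hk
    have hj : j ≠ i := fun h => hne (by rw [h, sub_self])
    have hk' : (i - 1 - j).val = k := by
      have := val_sub_one_add_one hne
      rw [show i - 1 - j = i - j - 1 by abel]
      omega
    have h1 := congrFun (congrFun (hQ.step hr hq hn i) κ) j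
    rw [mul_shiftMatrix_map, if_neg hj, mul_one] at h1
    rw [h1, companionVec_succ_add_one, Matrix.mul_apply, Matrix.mulVec, dotProduct]
    exact Finset.sum_congr rfl fun μ _ => by rw [ih i j hk' μ]

theorem IsChartDatum.eq_tauDatum {π : O} {α : O →+* A} (hr : 0 < r) (hq : 0 < q)
    (hn : r + q = n) {Q : Fin n → Matrix (Fin q) (Fin n) A}
    (hQ : IsChartDatum α (shiftMatrix π) (tauEquiv hn) Q) (i : Fin n) :
    tauDatum (firstColumns hq hn Q) i = Q i := by
  ext κ j
  exact (hQ.eq_companionVec hr hq hn _ i j rfl κ).symm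

/-- The relation of `IsChartDatum.step` at the one column where φ_i has the entry π, not used in the
recursion for the columns. -/
theorem IsChartDatum.companionVec_card_eq {π : O} {α : O →+* A} (hr : 0 < r) (hq : 0 < q)
    (hn : r + q = n) {Q : Fin n → Matrix (Fin q) (Fin n) A}
    (hQ : IsChartDatum α (shiftMatrix π) (tauEquiv hn) Q) (i : Fin n) (κ : Fin q) :
    companionVec (firstColumns hq hn Q) n i κ =
      α π * companionVec (firstColumns hq hn Q) 0 i κ := by
  obtain ⟨i, rfl⟩ : ∃ i', i = i' + 1 := ⟨i - 1, by rw [sub_add_cancel]⟩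
  have hi := i.pos
  have h0 : (i - 1 - i).val = n - 1 := by
    rw [show i - 1 - i = -1 - 0 by abel, val_neg_one_sub, Fin.val_zero, tsub_zero]
  have h1 := congrFun (congrFun (hQ.step hr hq hn i) κ) i
  rw [mul_shiftMatrix_map, if_pos rfl,
    hQ.eq_companionVec hr hq hn 0 (i + 1) i (by rw [add_sub_cancel_right, sub_self]; rfl)] at h1
  rw [mul_comm, h1]
  have h2 : companionVec (firstColumns hq hn Q) n (i + 1) =
      companionVec (firstColumns hq hn Q) (n - 1 + 1) (i + 1) :=
    congrArg (fun k => companionVec (firstColumns hq hn Q) k (i + 1)) (Nat.sub_add_cancel hi).symm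
  rw [h2, companionVec_succ_add_one, Matrix.mul_apply, Matrix.mulVec, dotProduct]
  exact Finset.sum_congr rfl fun μ _ => by rw [hQ.eq_companionVec hr hq hn _ i i h0 μ]

end TauChart

/-! ### The equation ring as coordinate ring of the chart of τ -/

section Universal

variable {O : Type u} [CommRing O] {n r : ℕ} [NeZero n]

/-- The coordinates on the equation scheme. -/
def equationCoord (π : O) (n r : ℕ) (i : Fin n) (κ : Fin (n - r)) :
    PolyRing O n r ⧸ equationIdeal π n r :=
  Ideal.Quotient.mk _ (MvPolynomial.X (i, κ))

theorem isUniversalDatum_equationCoord (π : O) (hr : 0 < r) (hrn : r < n) :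
    IsUniversalDatum (algebraMap O (PolyRing O n r ⧸ equationIdeal π n r)) (shiftMatrix π)
      (tauEquiv (Nat.add_sub_cancel' hrn.le)) (tauDatum (equationCoord π n r)) := by
  have hq : 0 < n - r := Nat.sub_pos_of_lt hrn
  have hn : r + (n - r) = n := Nat.add_sub_cancel' hrn.le
  refine ⟨isChartDatum_tauDatum hn _ ((companionProd_eq_scalar_iff _ _).mp fun i => ?_), ?_⟩
  · have h2 : (cyclicProduct O n r i - Matrix.scalar (Fin (n - r)) (MvPolynomial.C π)).map
        (Ideal.Quotient.mk (equationIdeal π n r)) = 0 := by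
      ext μ ν
      exact Ideal.Quotient.eq_zero_iff_mem.mpr (Ideal.subset_span ⟨i, μ, ν, rfl⟩)
    rw [Matrix.map_sub _ (map_sub (Ideal.Quotient.mk (equationIdeal π n r))), sub_eq_zero,
      cyclicProduct_eq, companionProd_map] at h2
    refine h2.trans ?_
    rw [Matrix.scalar_apply, Matrix.scalar_apply, Matrix.diagonal_map (map_zero _)]
    rfl
  · intro A _ α Q hQ
    let a := firstColumns hq hn Q
    let g : PolyRing O n r →+* A := MvPolynomial.eval₂Hom α fun x => a x.1 x.2
    have hgX : ∀ i κ, g (MvPolynomial.X (i, κ)) = a i κ := fun i κ =>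
      MvPolynomial.eval₂Hom_X' α _ (i, κ)
    have hgC : ∀ x, g (MvPolynomial.C x) = α x := fun x => MvPolynomial.eval₂Hom_C α _ x
    have hI : ∀ p ∈ equationIdeal π n r, g p = 0 := by
      intro p hp
      have : equationIdeal π n r ≤ RingHom.ker g := by
        refine Ideal.span_le.mpr ?_
        rintro _ ⟨i, μ, ν, rfl⟩
        have h1 := (companionProd_eq_scalar_iff a (α π)).mpr (hQ.companionVec_card_eq hr hq hn) i
        have h2 : (cyclicProduct O n r i - Matrix.scalar (Fin (n - r)) (MvPolynomial.C π)).map g =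
            0 := by
          rw [Matrix.map_sub _ (map_sub g), sub_eq_zero, cyclicProduct_eq, companionProd_map]
          simp only [hgX]
          refine h1.trans ?_
          rw [Matrix.scalar_apply, Matrix.scalar_apply, Matrix.diagonal_map (map_zero g), hgC]
        exact congrFun (congrFun h2 μ) ν
      exact this hp
    refine ⟨Ideal.Quotient.lift _ g hI, ⟨?_, ?_⟩, ?_⟩
    · ext x
      exact hgC x
    · intro i
      rw [tauDatum_map, ← hQ.eq_tauDatum hr hq hn i]
      congr 1
      funext i κ
      exact hgX i κ
    · rintro g' ⟨hg'α, hg'Q⟩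
      apply Ideal.Quotient.ringHom_ext
      apply MvPolynomial.ringHom_ext
      · intro x
        exact (congrArg (fun t => t x) hg'α).trans (hgC x).symm
      · rintro ⟨i, κ⟩
        -- Column i + r of Q_{i+1} is a^i, so the images of the variables are forced.
        have h1 := congrFun (congrFun (hg'Q (i + 1)) κ) (i + ⟨r, hrn⟩)
        rw [Matrix.map_apply, tauDatum_add_one hr hq hn] at h1
        exact h1.trans (hgX i κ).symm

end Universal

/-! ### Gluing of subbundles -/

section Gluing

variable {S T : Scheme.{u}} {n r : ℕ}

theorem bijective_appLE_image (g : T ⟶ S) [IsOpenImmersion g] (V : T.Opens)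
    (e : V ≤ g ⁻¹ᵁ (g ''ᵁ V)) : Function.Bijective (g.appLE (g ''ᵁ V) V e).hom := by
  rw [← Scheme.Hom.appIso_hom']
  exact ConcreteCategory.bijective_of_isIso (g.appIso V).hom

theorem bijective_appLE_preimage (g : T ⟶ S) [IsOpenImmersion g] {W : S.Opens}
    (hW : W ≤ g.opensRange) : Function.Bijective (g.appLE W (g ⁻¹ᵁ W) le_rfl).hom := by
  have := Scheme.Hom.isIso_app g W hW
  rw [Scheme.Hom.appLE_eq_app]
  exact ConcreteCategory.bijective_of_isIso (g.app W)

namespace Subbundle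

/-- Equal ranks make an inclusion of direct summands an equality. Locally B₁ = B₂ X, so C₁ B₁ = 1
gives (C₁ B₂) X = 1. These matrices are square, hence also X (C₁ B₂) = 1 and B₂ = B₁ (C₁ B₂). -/
theorem eq_of_le {F G : Subbundle S n r} (h : ∀ U, F.sections U ≤ G.sections U) : F = G := by
  ext1
  funext W
  refine le_antisymm (h W) fun s hs => F.glue W s fun x hx => ?_
  obtain ⟨U₁, hx₁, B₁, C₁, hCB₁, hF⟩ := F.locally_split x
  obtain ⟨U₂, hx₂, B₂, C₂, hCB₂, hG⟩ := G.locally_split x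
  have h₁ : W ⊓ (U₁ ⊓ U₂) ≤ U₁ := inf_le_right.trans inf_le_left
  have h₂ : W ⊓ (U₁ ⊓ U₂) ≤ U₂ := inf_le_right.trans inf_le_right
  refine ⟨W ⊓ (U₁ ⊓ U₂), inf_le_left, ⟨hx, hx₁, hx₂⟩, ?_⟩
  have hs' := G.res_mem (inf_le_left : W ⊓ (U₁ ⊓ U₂) ≤ W) s hs
  have hFG := h (W ⊓ (U₁ ⊓ U₂))
  rw [hG _ h₂] at hs' hFG
  rw [hF _ h₁] at hFG ⊢
  have hCB : resMat h₁ C₁ * resMat h₁ B₁ = 1 := by rw [← resMat_mul, hCB₁, resMat_one]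
  generalize resMat h₁ B₁ = B₁', resMat h₁ C₁ = C₁', resMat h₂ B₂ = B₂' at *
  choose X hX using fun k : Fin r => hFG ⟨Pi.single k 1, rfl⟩
  have hBX : B₂' * (Matrix.of X).transpose = B₁' := by
    apply Matrix.ext_of_mulVec_single
    intro k
    rw [← Matrix.mulVec_mulVec, Matrix.mulVec_single_one]
    exact hX k
  have h1 : (C₁' * B₂') * (Matrix.of X).transpose = 1 := by rw [Matrix.mul_assoc, hBX, hCB]
  have h2 := mul_eq_one_comm.mp h1
  obtain ⟨d, hd⟩ := hs'
  refine ⟨(C₁' * B₂').mulVec d, ?_⟩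
  rw [← hd, Matrix.mulVecLin_apply, Matrix.mulVecLin_apply, Matrix.mulVec_mulVec, ← hBX,
    Matrix.mul_assoc, h2, Matrix.mul_one]

/-- An open immersion identifies functions on V with functions on its image, so the span of the
pulled back sections consists of pulled back sections. -/
theorem mem_of_pullVec_mem (F : Subbundle S n r) (g : T ⟶ S) [IsOpenImmersion g] {W : S.Opens}
    (hW : W ≤ g.opensRange) (s : Fin n → Γ(S, W))
    (hs : pullVec g W (g ⁻¹ᵁ W) le_rfl s ∈ (F.pullback g).sections (g ⁻¹ᵁ W)) :
    s ∈ F.sections W := by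
  refine F.glue W s fun x hx => ?_
  obtain ⟨y, rfl⟩ := hW hx
  obtain ⟨V, hV, hyV, U, e, hU⟩ := hs y hx
  have hVW : g ''ᵁ V ≤ W := by
    rintro _ ⟨z, hz, rfl⟩
    exact hV hz
  have hVU : g ''ᵁ V ≤ U := by
    rintro _ ⟨z, hz, rfl⟩
    exact e hz
  have e' : V ≤ g ⁻¹ᵁ (g ''ᵁ V) := (g.preimage_image_eq V).ge
  refine ⟨g ''ᵁ V, hVW, ⟨y, hyV, rfl⟩, ?_⟩
  have h1 := F.resVec_mem_pullSpan g e e' hVU le_rfl _ hU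
  rw [resVec_self, resVec_pullVec, ← pullVec_resVec g hVW e'] at h1
  have hbij := bijective_appLE_image g V e'
  have h2 : ∀ z ∈ F.pullSpan g (g ''ᵁ V) V e', ∃ t ∈ F.sections (g ''ᵁ V),
      pullVec g (g ''ᵁ V) V e' t = z := by
    intro z hz
    induction hz using Submodule.span_induction with
    | mem t ht => exact ht
    | zero =>
      refine ⟨0, Submodule.zero_mem _, ?_⟩
      funext j; simp [pullVec]
    | add a b _ _ ha hb =>
      obtain ⟨a', ha', rfl⟩ := ha
      obtain ⟨b', hb', rfl⟩ := hb
      refine ⟨a' + b', Submodule.add_mem _ ha' hb', ?_⟩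
      funext j; simp [pullVec]
    | smul k b _ hb =>
      obtain ⟨b', hb', rfl⟩ := hb
      obtain ⟨k', rfl⟩ := hbij.2 k
      refine ⟨k' • b', Submodule.smul_mem _ _ hb', ?_⟩
      funext j; simp [pullVec]
  obtain ⟨t, ht, hts⟩ := h2 _ h1
  have : t = resVec hVW s := by
    funext j
    exact hbij.1 (congrFun hts j)
  rwa [← this]

theorem sections_le_of_pullback_eq (R : Sieve S)
    (hR : ∀ x : S, ∃ (T : Scheme.{u}) (g : T ⟶ S), R g ∧
      ∃ _ : IsOpenImmersion g, x ∈ g.opensRange)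
    {F G : Subbundle S n r} (h : ∀ {T : Scheme.{u}} (g : T ⟶ S), R g → F.pullback g = G.pullback g)
    (W : S.Opens) : F.sections W ≤ G.sections W := by
  intro s hs
  refine G.glue W s fun x hx => ?_
  obtain ⟨T, g, hg, hgo, hxg⟩ := hR x
  refine ⟨W ⊓ g.opensRange, inf_le_left, ⟨hx, hxg⟩, ?_⟩
  refine G.mem_of_pullVec_mem g inf_le_right _ ?_
  rw [← h g hg]
  exact F.pullVec_mem_pullback g _ _ (F.res_mem _ s hs)

theorem eq_of_pullback_eq (R : Sieve S)
    (hR : ∀ x : S, ∃ (T : Scheme.{u}) (g : T ⟶ S), R g ∧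
      ∃ _ : IsOpenImmersion g, x ∈ g.opensRange)
    {F G : Subbundle S n r} (h : ∀ {T : Scheme.{u}} (g : T ⟶ S), R g → F.pullback g = G.pullback g) :
    F = G :=
  eq_of_le fun W => sections_le_of_pullback_eq R hR h W

variable (R : Sieve S) (F : ∀ (T : Scheme.{u}) (g : T ⟶ S), R g → Subbundle T n r)
  (hF : ∀ {T T' : Scheme.{u}} (g : T ⟶ S) (h : T' ⟶ T) (hg : R g),
    F _ (h ≫ g) (R.downward_closed hg h) = (F _ g hg).pullback h)

/-- The sections of `O_S^n` whose pullbacks lie in the given compatible subbundles. -/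
def gluedSections (W : S.Opens) : Submodule Γ(S, W) (Fin n → Γ(S, W)) where
  carrier := {s | ∀ {T : Scheme.{u}} (g : T ⟶ S) (hg : R g),
    pullVec g W (g ⁻¹ᵁ W) le_rfl s ∈ (F _ g hg).sections (g ⁻¹ᵁ W)}
  zero_mem' := by
    intro T g hg
    convert Submodule.zero_mem ((F _ g hg).sections (g ⁻¹ᵁ W)) using 1
    funext j; simp [pullVec]
  add_mem' := by
    intro s t hs ht T g hg
    convert Submodule.add_mem _ (hs g hg) (ht g hg) using 1
    funext j; simp [pullVec]
  smul_mem' := by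
    intro a s hs T g hg
    convert Submodule.smul_mem _ ((g.appLE W (g ⁻¹ᵁ W) le_rfl).hom a) (hs g hg) using 1
    funext j; simp [pullVec]

include hF in
-- One open immersion covering W suffices. For another g' in the sieve, pass to the fibre product
-- with g: its projection to the source of g' is an open immersion covering the preimage of W, so
-- membership descends along it.
theorem mem_gluedSections {T : Scheme.{u}} (g : T ⟶ S) [IsOpenImmersion g] (hg : R g)
    {W : S.Opens} (hW : W ≤ g.opensRange) (s : Fin n → Γ(S, W)) :
    s ∈ gluedSections R F W ↔ pullVec g W (g ⁻¹ᵁ W) le_rfl s ∈ (F _ g hg).sections (g ⁻¹ᵁ W) := by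
  refine ⟨fun h => h g hg, fun hs T' g' hg' => ?_⟩
  have hrange : g' ⁻¹ᵁ W ≤ (Limits.pullback.fst g' g).opensRange := by
    intro x hx
    obtain ⟨y, hy⟩ := hW hx
    obtain ⟨z, hz, _⟩ := Scheme.Pullback.exists_preimage_pullback x y hy.symm
    exact ⟨z, hz⟩
  have hcond : Limits.pullback.fst g' g ≫ g' = Limits.pullback.snd g' g ≫ g :=
    Limits.pullback.condition
  refine (F _ g' hg').mem_of_pullVec_mem (Limits.pullback.fst g' g) hrange _ ?_
  rw [← hF, pullVec_pullVec]
  -- The subbundle depends on the morphism itself, so the two equal composites to S are exchanged by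
  -- substitution.
  have key : ∀ (k : Limits.pullback g' g ⟶ S) (hk : k = Limits.pullback.snd g' g ≫ g) (hRk : R k),
      pullVec k W (k ⁻¹ᵁ W) le_rfl s ∈ (F _ k hRk).sections (k ⁻¹ᵁ W) := by
    rintro _ rfl hRk
    rw [hF g _ hg]
    have h1 := (F _ g hg).pullVec_mem_pullback (Limits.pullback.snd g' g)
      (le_refl (Limits.pullback.snd g' g ⁻¹ᵁ (g ⁻¹ᵁ W))) _ hs
    rw [pullVec_pullVec] at h1
    exact h1
  exact key _ hcond _

include hF in
theorem exists_glue
    (hR : ∀ x : S, ∃ (T : Scheme.{u}) (g : T ⟶ S), R g ∧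
      ∃ _ : IsOpenImmersion g, x ∈ g.opensRange) :
    ∃ G : Subbundle S n r, ∀ {T : Scheme.{u}} (g : T ⟶ S) (hg : R g), G.pullback g = F _ g hg := by
  let G : Subbundle S n r :=
    { sections := gluedSections R F
      res_mem := by
        intro U V h s hs T g hg
        have hle : g ⁻¹ᵁ V ≤ g ⁻¹ᵁ U := g.preimage_mono h
        have h1 := (F _ g hg).res_mem hle _ (hs g hg)
        rw [resVec_pullVec] at h1
        rwa [pullVec_resVec]
      glue := by
        intro U s H T g hg
        refine (F _ g hg).glue _ _ fun x hx => ?_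
        obtain ⟨V, h, hxV, hV⟩ := H (g x) hx
        have hle : g ⁻¹ᵁ V ≤ g ⁻¹ᵁ U := g.preimage_mono h
        refine ⟨g ⁻¹ᵁ V, hle, hxV, ?_⟩
        have h1 := hV g hg
        rw [pullVec_resVec] at h1
        rwa [resVec_pullVec]
      locally_split := by
        intro x
        obtain ⟨T, g, hg, hgo, ⟨y, rfl⟩⟩ := hR x
        obtain ⟨V, hyV, B, C, hCB, hB⟩ := (F _ g hg).locally_split y
        have e : V ≤ g ⁻¹ᵁ (g ''ᵁ V) := (g.preimage_image_eq V).ge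
        have hinv : ∀ {k l : ℕ} (M : Matrix (Fin k) (Fin l) Γ(T, V)),
            (M.map (g.appIso V).inv.hom).map (g.appLE (g ''ᵁ V) V e).hom = M := by
          intro k l M
          ext i j
          rw [← Scheme.Hom.appIso_hom']
          simp only [Matrix.map_apply]
          rw [← CommRingCat.comp_apply, Iso.inv_hom_id]
          rfl
        refine ⟨g ''ᵁ V, ⟨y, hyV, rfl⟩, B.map (g.appIso V).inv.hom, C.map (g.appIso V).inv.hom,
          ?_, ?_⟩
        · rw [← Matrix.map_mul, hCB, Matrix.map_one _ (map_zero _) (map_one _)]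
        · intro W hW
          have hWr : W ≤ g.opensRange := by
            intro z hz
            obtain ⟨w, _, rfl⟩ := hW hz
            exact ⟨w, rfl⟩
          have hWV : g ⁻¹ᵁ W ≤ V := by
            intro z hz
            have : z ∈ g ⁻¹ᵁ (g ''ᵁ V) := hW hz
            rwa [g.preimage_image_eq] at this
          have hbij := bijective_appLE_preimage g hWr
          have hBW : (resMat hW (B.map (g.appIso V).inv.hom)).map
              (g.appLE W (g ⁻¹ᵁ W) le_rfl).hom = resMat hWV B := by
            conv_rhs => rw [← hinv B, resMat_map_appLE]
            ext i j
            simp only [resMat, Matrix.map_apply]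
            rw [← CommRingCat.comp_apply, Scheme.Hom.map_appLE]
          ext s
          rw [mem_gluedSections R F hF g hg hWr, hB _ hWV, ← hBW]
          constructor
          · rintro ⟨c, hc⟩
            choose c' hc' using fun k => hbij.2 (c k)
            refine ⟨c', ?_⟩
            have hcc : pullVec g W (g ⁻¹ᵁ W) le_rfl c' = c := funext hc'
            rw [Matrix.mulVecLin_apply, ← hcc, ← pullVec_mulVec] at hc
            funext j
            exact hbij.1 (congrFun hc j)
          · rintro ⟨c, rfl⟩
            refine ⟨pullVec g W (g ⁻¹ᵁ W) le_rfl c, ?_⟩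
            rw [Matrix.mulVecLin_apply, Matrix.mulVecLin_apply, pullVec_mulVec] }
  -- Pulled back glued sections lie in the given subbundle by definition, and equality of ranks
  -- gives the rest.
  refine ⟨G, fun {T} g hg => eq_of_le fun W => ?_⟩
  refine G.pullSections_le g (F _ g hg).sections (F _ g hg).glue ?_ W
  intro U V e s hs
  have h1 := (F _ g hg).res_mem e _ (hs g hg)
  rwa [resVec_pullVec] at h1

end Subbundle

end Gluing

/-! ### Representability -/

section OpenSubfunctor

/-- A section `ξ` over `X` of a presheaf on schemes which is universal among the sections `x` with
`D x = ⊤`, where `D` is an open condition, defines an open immersion. -/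
theorem isOpenImmersion_presheaf_of_existsUnique (G : Scheme.{u}ᵒᵖ ⥤ Type u)
    (D : ∀ {S : Scheme.{u}}, G.obj (op S) → S.Opens)
    (hD : ∀ {S T : Scheme.{u}} (f : T ⟶ S) (x : G.obj (op S)), D (G.map f.op x) = f ⁻¹ᵁ D x)
    {X : Scheme.{u}} (ξ : G.obj (op X)) (hξ : D ξ = ⊤)
    (h : ∀ {T : Scheme.{u}} (x : G.obj (op T)), D x = ⊤ → ∃! f : T ⟶ X, G.map f.op ξ = x) :
    IsOpenImmersion.presheaf (yonedaEquiv.symm ξ) := by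
  refine MorphismProperty.relative.of_exists fun S g => ?_
  obtain ⟨x, rfl⟩ := yonedaEquiv.symm.surjective g
  have hV : D (G.map (D x).ι.op x) = ⊤ := by rw [hD]; simp
  obtain ⟨a, ha, -⟩ := h _ hV
  -- The fibre product of X and S over G is the open subscheme D x: b : T → S factors through it
  -- when the pullback of x along b satisfies the condition.
  refine ⟨(D x).toScheme, yoneda.map a, (D x).ι, ?_, inferInstance⟩
  refine IsPullback.of_forall_isPullback_app fun T => ?_
  rw [Limits.Types.isPullback_iff]
  refine ⟨?_, ?_, ?_⟩
  · rw [← NatTrans.comp_app, ← NatTrans.comp_app, yonedaEquiv_symm_naturality_left,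
      yonedaEquiv_symm_naturality_left, ha]
  · rintro (f : T.unop ⟶ _) (f' : T.unop ⟶ _) ⟨-, hf⟩
    exact (cancel_mono (D x).ι).mp hf
  · rintro (f : T.unop ⟶ X) (b : T.unop ⟶ S) hfb
    have hfb' : G.map f.op ξ = G.map b.op x := by
      rw [yonedaEquiv_symm_app, yonedaEquiv_symm_app] at hfb
      exact hfb
    have htop : D (G.map b.op x) = ⊤ := by
      rw [← hfb', hD, hξ]
      rfl
    have hrange : Set.range b ⊆ Set.range (D x).ι := by
      rw [hD] at htop
      rw [Scheme.Opens.range_ι]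
      rintro _ ⟨y, rfl⟩
      exact (htop ▸ trivial : y ∈ b ⁻¹ᵁ D x)
    have hlift := IsOpenImmersion.lift_fac (D x).ι b hrange
    refine ⟨IsOpenImmersion.lift (D x).ι b hrange, ?_, hlift⟩
    obtain ⟨_, _, huniq⟩ := h _ htop
    refine (huniq _ ?_).trans (huniq _ hfb').symm
    change G.map (IsOpenImmersion.lift (D x).ι b hrange ≫ a).op ξ = _
    rw [op_comp, Functor.map_comp_apply, ha, ← Functor.map_comp_apply, ← op_comp, hlift]

end OpenSubfunctor

section Representability

variable {O : Type u} [CommRing O] {m n r q : ℕ}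

/-- A compatible family over the scheme `S` endowed with some morphism to `Spec O`. -/
structure FamilyOver (φ : Fin m → Matrix (Fin n) (Fin n) O) (r : ℕ) (S : Scheme.{u}) where
  base : S ⟶ Spec (CommRingCat.of O)
  fam : CompatibleFamily φ r (Over.mk base)

variable {φ : Fin m → Matrix (Fin n) (Fin n) O}

namespace FamilyOver

/-- The members of the family. -/
def sub {S : Scheme.{u}} (x : FamilyOver φ r S) (i : Fin m) : Subbundle S n r := x.fam.sub i

theorem ext' {S : Scheme.{u}} {x y : FamilyOver φ r S} (h : x.base = y.base)
    (h' : ∀ i, x.sub i = y.sub i) : x = y := by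
  obtain ⟨p, F⟩ := x
  obtain ⟨p', F'⟩ := y
  obtain rfl : p = p' := h
  obtain rfl : F = F' := CompatibleFamily.ext (funext h')
  rfl

theorem compat {S : Scheme.{u}} (x : FamilyOver φ r S) {p : S ⟶ Spec (CommRingCat.of O)}
    (hp : x.base = p) (i : Fin m) (U : S.Opens) (s : Fin n → Γ(S, U))
    (hs : s ∈ (x.sub i).sections U) :
    ((φ i).map (structMap (Over.mk p) U)).mulVec s ∈ (x.sub (next i)).sections U := by
  subst hp
  exact x.fam.compat i U s hs

/-- Base change along a morphism of schemes. -/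
def pullback {S T : Scheme.{u}} (x : FamilyOver φ r S) (f : T ⟶ S) : FamilyOver φ r T where
  base := f ≫ x.base
  fam := x.fam.pullback (Over.homMk f : Over.mk (f ≫ x.base) ⟶ Over.mk x.base)

theorem sub_pullback {S T : Scheme.{u}} (x : FamilyOver φ r S) (f : T ⟶ S) (i : Fin m) :
    (x.pullback f).sub i = (x.sub i).pullback f := rfl

end FamilyOver

/-- The presheaf on schemes of compatible families over some morphism to `Spec O`. -/
def familyFunctor (φ : Fin m → Matrix (Fin n) (Fin n) O) (r : ℕ) : Scheme.{u}ᵒᵖ ⥤ Type u where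
  obj S := FamilyOver φ r S.unop
  map f := ↾(fun x => x.pullback f.unop)
  map_id S := by
    refine ConcreteCategory.hom_ext _ _ fun x => ?_
    exact FamilyOver.ext' (Category.id_comp _) fun i => (x.sub i).pullback_id
  map_comp f g := by
    refine ConcreteCategory.hom_ext _ _ fun x => ?_
    exact FamilyOver.ext' (Category.assoc _ _ _) fun i => (x.sub i).pullback_comp f.unop g.unop

theorem isSheaf_familyFunctor : Presieve.IsSheaf Scheme.zariskiTopology (familyFunctor φ r) := by
  intro X R hRX x hx
  have hR : ∀ z : X, ∃ (T : Scheme.{u}) (g : T ⟶ X), R g ∧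
      ∃ _ : IsOpenImmersion g, z ∈ g.opensRange := by
    intro z
    obtain ⟨𝒰, h𝒰⟩ := Scheme.exists_cover_of_mem_grothendieckTopology hRX
    obtain ⟨i, y, hy⟩ := 𝒰.exists_eq z
    exact ⟨_, 𝒰.f i, h𝒰 _ _ (Presieve.ofArrows.mk i), 𝒰.map_prop i, y, hy⟩
  let x' : ∀ (T : Scheme.{u}) (g : T ⟶ X), R g → FamilyOver φ r T := fun T g hg => x g hg
  have hx' : ∀ {T T' : Scheme.{u}} (g : T ⟶ X) (h : T' ⟶ T) (hg : R g),
      x' T' (h ≫ g) (R.downward_closed hg h) = (x' T g hg).pullback h := fun g h hg =>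
    (Presieve.compatible_iff_sieveCompatible x).mp hx g h hg
  -- The structure morphisms glue because the Zariski topology is subcanonical.
  have hbase := (GrothendieckTopology.Subcanonical.isSheaf_of_isRepresentable
    (J := Scheme.zariskiTopology) (yoneda.obj (Spec (CommRingCat.of O)))) R hRX
    (fun T g hg => (x' T g hg).base) ((Presieve.compatible_iff_sieveCompatible _).mpr
      fun {T T'} g h hg => congrArg FamilyOver.base (hx' g h hg))
  obtain ⟨p, hp, hpuniq⟩ := hbase
  have hp' : ∀ {T : Scheme.{u}} (g : T ⟶ X) (hg : R g), g ≫ p = (x' T g hg).base :=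
    fun g hg => hp g hg
  choose G hG using fun i => Subbundle.exists_glue R (fun T g hg => (x' T g hg).sub i)
    (fun g h hg => by rw [hx' g h hg, FamilyOver.sub_pullback]) hR
  let y : FamilyOver φ r X :=
    { base := p
      fam :=
        { sub := G
          compat := by
            intro i U s hs
            -- Compatibility of the glued subbundles is local and can be checked after pullback
            -- along open immersions of the sieve.
            refine (G (next i)).glue _ _ fun z hz => ?_
            obtain ⟨T, g, hg, hgo, hzg⟩ := hR z
            let W : X.Opens := U ⊓ g.opensRange
            have hWU : W ≤ U := inf_le_left
            refine ⟨W, hWU, ⟨hz, hzg⟩, ?_⟩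
            refine (G (next i)).mem_of_pullVec_mem g inf_le_right _ ?_
            have h1 := (G i).pullVec_mem_pullback g (le_refl (g ⁻¹ᵁ W)) _
              ((G i).res_mem hWU s hs)
            rw [hG i g hg] at h1
            have h2 := (x' T g hg).compat (hp' g hg).symm i _ _ h1
            rw [hG (next i) g hg, resVec_mulVec, pullVec_mulVec]
            have h3 : (resMat hWU ((φ i).map (structMap (Over.mk p) U))).map
                (g.appLE W (g ⁻¹ᵁ W) le_rfl).hom =
                (φ i).map (structMap (Over.mk (g ≫ p)) (g ⁻¹ᵁ W)) := by
              have h4 := resMat_structMap (Over.mk p) hWU (φ i)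
              ext a b
              rw [Matrix.map_apply]
              have h5 := congrFun (congrFun h4 a) b
              refine (congrArg _ h5).trans ?_
              exact appLE_structMap (Over.homMk g : Over.mk (g ≫ p) ⟶ Over.mk p) W (g ⁻¹ᵁ W) le_rfl
                (φ i a b)
            exact h3 ▸ h2 } }
  refine ⟨y, ?_, ?_⟩
  · intro T g hg
    exact FamilyOver.ext' (hp' g hg) fun i => hG i g hg
  · intro y' hy'
    have hy'' : ∀ {T : Scheme.{u}} (g : T ⟶ X) (hg : R g),
        FamilyOver.pullback (y' : FamilyOver φ r X) g = x' T g hg := fun g hg => hy' g hg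
    refine FamilyOver.ext' (hpuniq _ fun T g hg => congrArg FamilyOver.base (hy'' g hg)) fun i => ?_
    refine Subbundle.eq_of_pullback_eq R hR fun g hg => ?_
    refine Eq.trans ?_ (hG i g hg).symm
    exact congrArg (fun w => FamilyOver.sub w i) (hy'' g hg)

theorem exists_isChart (φ : Fin m → Matrix (Fin n) (Fin n) O) (c : Fin m → Fin r ⊕ Fin q ≃ Fin n) :
    ∃ (X : Scheme.{u}) (p : X ⟶ Spec (CommRingCat.of O)) (ξ : CompatibleFamily φ r (Over.mk p)),
      IsChart c ξ := by
  obtain ⟨R, _, ρ, Q, hQ⟩ := exists_isUniversalDatum φ c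
  exact ⟨_, _, _, hQ.isChart⟩

/-- The open subset of a scheme where a family lies in the chart `c`. -/
def familyLocus (c : Fin m → Fin r ⊕ Fin q ≃ Fin n) {S : Scheme.{u}}
    (x : (familyFunctor φ r).obj (op S)) : S.Opens :=
  chartLocus c (FamilyOver.sub x)

theorem IsChart.existsUnique_familyOver {c : Fin m → Fin r ⊕ Fin q ≃ Fin n} {X : Scheme.{u}}
    {p : X ⟶ Spec (CommRingCat.of O)} {ξ : CompatibleFamily φ r (Over.mk p)} (hξ : IsChart c ξ)
    {T : Scheme.{u}} (x : FamilyOver φ r T) (hx : chartLocus c x.sub = ⊤) :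
    ∃! f : T ⟶ X, (⟨p, ξ⟩ : FamilyOver φ r X).pullback f = x := by
  obtain ⟨f, hf, huniq⟩ := hξ.existsUnique x.fam hx
  refine ⟨f.left, ?_, ?_⟩
  · refine FamilyOver.ext' (Over.w f) fun i => ?_
    exact congrArg (fun F => CompatibleFamily.sub F i) hf
  · intro g hg
    have hbase : g ≫ p = x.base := congrArg FamilyOver.base hg
    have := huniq (Over.homMk g hbase) (CompatibleFamily.ext (funext fun i =>
      congrArg (fun w => FamilyOver.sub w i) hg))
    rw [← this]
    rfl

/-- The local criterion concerns sheaves on all schemes, so the structure morphism is made part of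
the data. -/
theorem isRepresentable_familyFunctor (φ : Fin m → Matrix (Fin n) (Fin n) O) (hn : n = r + q) :
    (familyFunctor φ r).IsRepresentable := by
  let ι : Type u := ULift.{u} (Fin m → Fin r ⊕ Fin q ≃ Fin n)
  choose X p ξ hξ using fun c : ι => exists_isChart φ c.down
  let F : Sheaf Scheme.zariskiTopology.{u} (Type u) :=
    ⟨familyFunctor φ r, (isSheaf_iff_isSheaf_of_type _ _).mpr isSheaf_familyFunctor⟩
  let x : ∀ c : ι, F.1.obj (op (X c)) := fun c => (⟨p c, ξ c⟩ : FamilyOver φ r (X c))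
  let f : ∀ c : ι, yoneda.obj (X c) ⟶ F.1 := fun c => yonedaEquiv.symm (x c)
  have hf : ∀ c, IsOpenImmersion.presheaf (f c) := fun c =>
    isOpenImmersion_presheaf_of_existsUnique (familyFunctor φ r) (familyLocus c.down)
      (fun g y => chartLocus_pullback c.down (FamilyOver.sub y) g) (x c) (hξ c).locus
      (fun y hy => (hξ c).existsUnique_familyOver y hy)
  have hsurj : Presheaf.IsLocallySurjective Scheme.zariskiTopology (Limits.Sigma.desc f) := by
    refine ⟨fun {S} y => ?_⟩
    let U : ι → S.Opens := fun c => familyLocus c.down y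
    have hU : IsOpenCover U := by
      rw [IsOpenCover, eq_top_iff]
      intro z _
      obtain ⟨c, hc⟩ := exists_mem_chartLocus hn (FamilyOver.sub y) z
      exact Opens.mem_iSup.mpr ⟨⟨c⟩, hc⟩
    refine Scheme.mem_grothendieckTopology_iff.mpr ⟨S.openCoverOfIsOpenCover U hU, ?_⟩
    rintro _ _ ⟨c⟩
    have htop : familyLocus c.down ((familyFunctor φ r).map (U c).ι.op y) = ⊤ := by
      refine (chartLocus_pullback c.down (FamilyOver.sub y) (U c).ι).trans ?_
      exact Scheme.Opens.ι_preimage_self _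
    obtain ⟨g, hg, -⟩ := (hξ c).existsUnique_familyOver _ htop
    refine ⟨(Limits.Sigma.ι (fun c => yoneda.obj (X c)) c).app _ g, ?_⟩
    have h1 : Limits.Sigma.ι (fun c => yoneda.obj (X c)) c ≫ Limits.Sigma.desc f = f c :=
      Limits.Sigma.ι_desc _ _
    have h2 := congrArg (fun t => t.app (op (U c).toScheme) g) h1
    refine Eq.trans h2 ?_
    exact hg
  exact Scheme.LocalRepresentability.isRepresentable (F := F) hf

/-- The universal pair over M contains a morphism M → Spec O. Morphisms T → M over Spec O are those
for which the first member of the pulled back pair is the given structure morphism. -/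
theorem isRepresentable_compatibleSubspaces (φ : Fin m → Matrix (Fin n) (Fin n) O)
    (hn : n = r + q) : (compatibleSubspaces φ r).IsRepresentable := by
  obtain ⟨M, ⟨h⟩⟩ := isRepresentable_familyFunctor φ hn
  let ξ : FamilyOver φ r M := h.homEquiv (𝟙 M)
  have hξ : ∀ {T : Scheme.{u}} (f : T ⟶ M), h.homEquiv f = ξ.pullback f := by
    intro T f
    have := h.homEquiv_comp f (𝟙 M)
    rwa [Category.comp_id] at this
  have hbij : ∀ T : Over (Spec (CommRingCat.of O)), Function.Bijective
      (fun f : T ⟶ Over.mk ξ.base => ξ.fam.pullback f) := by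
    intro T
    constructor
    · intro f g hfg
      apply Over.OverMorphism.ext
      apply h.homEquiv.injective
      rw [hξ, hξ]
      refine FamilyOver.ext' ((Over.w f).trans (Over.w g).symm) fun i => ?_
      exact congrArg (fun F => CompatibleFamily.sub F i) hfg
    · intro F
      let y : FamilyOver φ r T.left := ⟨T.hom, F⟩
      obtain ⟨f, hf⟩ := h.homEquiv.surjective y
      rw [hξ] at hf
      refine ⟨Over.homMk f (congrArg FamilyOver.base hf), ?_⟩
      exact CompatibleFamily.ext (funext fun i => congrArg (fun w => FamilyOver.sub w i) hf)
  refine ⟨Over.mk ξ.base, ⟨⟨fun {T} => Equiv.ofBijective _ (hbij T), ?_⟩⟩⟩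
  intro T T' f g
  refine CompatibleFamily.ext (funext fun i => ?_)
  exact (ξ.sub i).pullback_comp g.left f.left

end Representability

/-! ### The open subset `U_τ` -/

section ChartOfRepresenting

variable {O : Type u} [CommRing O] {m n r q : ℕ} {φ : Fin m → Matrix (Fin n) (Fin n) O}
  {c : Fin m → Fin r ⊕ Fin q ≃ Fin n}

theorem IsChart.nonempty_iso {Y Y' : Over (Spec (CommRingCat.of O))} {ξ : CompatibleFamily φ r Y}
    {ξ' : CompatibleFamily φ r Y'} (h : IsChart c ξ) (h' : IsChart c ξ') : Nonempty (Y ≅ Y') := by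
  obtain ⟨f, hf, -⟩ := h'.existsUnique ξ h.locus
  obtain ⟨g, hg, -⟩ := h.existsUnique ξ' h'.locus
  have hcomp : ∀ {S S' S'' : Over (Spec (CommRingCat.of O))} (F : CompatibleFamily φ r S)
      (a : S' ⟶ S) (b : S'' ⟶ S'), F.pullback (b ≫ a) = (F.pullback a).pullback b :=
    fun F a b => CompatibleFamily.ext (funext fun i => (F.sub i).pullback_comp a.left b.left)
  have hid : ∀ {S : Over (Spec (CommRingCat.of O))} (F : CompatibleFamily φ r S),
      F.pullback (𝟙 S) = F :=
    fun F => CompatibleFamily.ext (funext fun i => (F.sub i).pullback_id)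
  refine ⟨⟨f, g, ?_, ?_⟩⟩
  · exact (h.existsUnique ξ h.locus).unique (by rw [hcomp, hg, hf]) (hid ξ)
  · exact (h'.existsUnique ξ' h'.locus).unique (by rw [hcomp, hf, hg]) (hid ξ')

theorem homEquiv_eq_pullback {M T : Over (Spec (CommRingCat.of O))}
    (h : (compatibleSubspaces φ r).RepresentableBy M) (f : T ⟶ M) :
    h.homEquiv f = CompatibleFamily.pullback (h.homEquiv (𝟙 M)) f := by
  have := h.homEquiv_comp f (𝟙 M)
  rwa [Category.comp_id] at this

/-- A morphism to M factors through U exactly when the preimage of U is everything, and this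
preimage is the chart locus of the pulled back family. -/
theorem isChart_of_representableBy {M : Over (Spec (CommRingCat.of O))}
    (h : (compatibleSubspaces φ r).RepresentableBy M) {U : M.left.Opens}
    (hU : U = chartLocus c (CompatibleFamily.sub (h.homEquiv (𝟙 M)))) :
    IsChart c (CompatibleFamily.pullback (h.homEquiv (𝟙 M))
      (Over.homMk U.ι : Over.mk (U.ι ≫ M.hom) ⟶ M)) where
  locus := by
    refine (chartLocus_pullback c (CompatibleFamily.sub (h.homEquiv (𝟙 M))) U.ι).trans ?_
    rw [← hU]
    exact Scheme.Opens.ι_preimage_self _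
  existsUnique {T} F hF := by
    obtain ⟨f, rfl⟩ := h.homEquiv.surjective F
    have hpull : ∀ g : T ⟶ Over.mk (U.ι ≫ M.hom),
        CompatibleFamily.pullback (CompatibleFamily.pullback (h.homEquiv (𝟙 M))
          (Over.homMk U.ι : Over.mk (U.ι ≫ M.hom) ⟶ M)) g =
        h.homEquiv (g ≫ (Over.homMk U.ι : Over.mk (U.ι ≫ M.hom) ⟶ M)) := by
      intro g
      refine Eq.trans ?_ (homEquiv_eq_pullback h _).symm
      exact CompatibleFamily.ext (funext fun i =>
        ((CompatibleFamily.sub (h.homEquiv (𝟙 M)) i).pullback_comp U.ι g.left).symm)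
    have htop : f.left ⁻¹ᵁ U = ⊤ := by
      rw [homEquiv_eq_pullback h] at hF
      rw [hU]
      exact (chartLocus_pullback c _ f.left).symm.trans hF
    have hrange : Set.range f.left ⊆ Set.range U.ι := by
      rw [Scheme.Opens.range_ι]
      rintro _ ⟨y, rfl⟩
      exact (htop ▸ trivial : y ∈ f.left ⁻¹ᵁ U)
    have hlift := IsOpenImmersion.lift_fac U.ι f.left hrange
    refine ⟨Over.homMk (IsOpenImmersion.lift U.ι f.left hrange) ?_, ?_, ?_⟩
    · change _ ≫ U.ι ≫ M.hom = _
      rw [← Category.assoc, hlift, Over.w]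
    · refine (hpull _).trans (congrArg h.homEquiv ?_)
      apply Over.OverMorphism.ext
      exact hlift
    · intro g hg
      have h1 := h.homEquiv.injective ((hpull g).symm.trans hg)
      apply Over.OverMorphism.ext
      apply (cancel_mono U.ι).mp
      exact (congrArg CommaMorphism.left h1).trans hlift.symm

end ChartOfRepresenting

/-! ### The alcove τ as a choice of cyclic intervals, and the origin of its chart -/

section Tau

variable {O : Type u} [CommRing O] {n r q : ℕ} [NeZero n]

theorem tau_tauEquiv_inl (hn : r + q = n) (i : Fin n) (l : Fin r) :
    tau r i (tauEquiv hn i (Sum.inl l)) = omega i (tauEquiv hn i (Sum.inl l)) + 1 := by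
  have hi := i.2
  have hl := l.2
  simp only [tauEquiv_inl, tau, omega, Fin.lt_def, Fin.val_add_eq_ite]
  split_ifs <;> omega

theorem tau_tauEquiv_inr (hn : r + q = n) (i : Fin n) (κ : Fin q) :
    omega i (tauEquiv hn i (Sum.inr κ)) = tau r i (tauEquiv hn i (Sum.inr κ)) := by
  have hi := i.2
  have hκ := κ.2
  simp only [tauEquiv_inr, tau, omega, Fin.lt_def, Fin.val_add_eq_ite]
  split_ifs <;> omega

theorem setOf_omega_eq_tau (hn : r + q = n) (i : Fin n) :
    {j | omega i j = tau r i j} = Set.range (tauEquiv hn i ∘ Sum.inr) := by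
  ext j
  obtain ⟨j, rfl⟩ := (tauEquiv hn i).surjective j
  rcases j with l | κ
  · have := tau_tauEquiv_inl hn i l
    simp [this]
  · simp [tau_tauEquiv_inr hn i κ]

theorem setOf_tau_eq_omega_add_one (hn : r + q = n) (i : Fin n) :
    {j | tau r i j = omega i j + 1} = Set.range (tauEquiv hn i ∘ Sum.inl) := by
  ext j
  obtain ⟨j, rfl⟩ := (tauEquiv hn i).surjective j
  rcases j with l | κ
  · simp [tau_tauEquiv_inl hn i l]
  · simp [tau_tauEquiv_inr hn i κ]

theorem tauLocus_eq_chartLocus (hn : r + q = n) {φ : Fin n → Matrix (Fin n) (Fin n) O}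
    {S : Over (Spec (CommRingCat.of O))} (F : CompatibleFamily φ r S) :
    tauLocus F = chartLocus (tauEquiv hn) F.sub := by
  ext x
  change (∀ i, x ∈ (F.sub i).generatedLocus _) ↔ ∀ i, x ∈ (F.sub i).generatedLocus _
  simp only [setOf_omega_eq_tau hn]

variable {A : Type*} [CommRing A]

/-- With zero first columns the companion matrices only shift, and q shifts kill the last basis
vector. -/
theorem companionVec_zero_eq_zero (hq : 0 < q) {k : ℕ} (hk : q ≤ k) (i : Fin n) :
    companionVec (0 : Fin n → Fin q → A) k i = 0 := by
  obtain ⟨j, rfl⟩ := Nat.exists_eq_add_of_le' hk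
  rw [companionVec_add, ← sub_add_cancel (subOnes i j) 1, companionVec_card _ hq, Pi.zero_apply,
    Matrix.mulVec_zero]

theorem tauDatum_zero (hq : 0 < q) (hn : r + q = n) (i : Fin n) :
    tauDatum (0 : Fin n → Fin q → A) i = (inrMatrix (tauEquiv hn i) A).transpose := by
  ext κ j
  obtain ⟨j, rfl⟩ := (tauEquiv hn i).surjective j
  rcases j with l | ν
  · have hl := l.2
    rw [tauDatum, Matrix.of_apply, tauEquiv_inl,
      show i - 1 - (i + ⟨l.1, by omega⟩) = -1 - (⟨l.1, by omega⟩ : Fin n) by abel,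
      val_neg_one_sub, companionVec_zero_eq_zero hq (by simp only; omega), ← tauEquiv_inl hn]
    simp [inrMatrix]
  · rw [tauDatum_inr]
    simp [inrMatrix, Matrix.one_apply, eq_comm]

theorem isChartDatum_zero {π : O} {α : O →+* A} (hq : 0 < q) (hn : r + q = n) (hπ : α π = 0) :
    IsChartDatum α (shiftMatrix π) (tauEquiv hn) (tauDatum (0 : Fin n → Fin q → A)) := by
  refine isChartDatum_tauDatum hn _ fun i κ => ?_
  rw [companionVec_zero_eq_zero hq (by omega), hπ, zero_mul]
  rfl

theorem isTauFamily_chartFamily {φ : Fin n → Matrix (Fin n) (Fin n) O} (hq : 0 < q)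
    (hn : r + q = n) {S : Over (Spec (CommRingCat.of O))}
    (hQ : IsChartDatum (structMap S ⊤) φ (tauEquiv hn) (tauDatum 0)) :
    IsTauFamily (chartFamily S _ hQ) := by
  intro i U
  ext s
  rw [setOf_tau_eq_omega_add_one hn, isKerOn_chartFamily S _ hQ i U le_top, tauDatum_zero hq hn,
    resMat_transpose, resMat_inrMatrix, ker_inrMatrix_transpose]

end Tau

/-! ### The two statements about U_τ -/

section Main

variable {O : Type u} [CommRing O] [IsDomain O]

theorem transitionMatrix_eq_shiftMatrix {π : O} (hπ : π ≠ 0) (n : ℕ) :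
    (fun i : Fin n => transitionMatrix hπ i) = shiftMatrix π :=
  funext fun i => transitionMatrix_eq hπ i

theorem nonempty_Utau_iso {π : O} (hπ : π ≠ 0) {n r : ℕ} (hr : 0 < r) (hrn : r < n)
    {M : Over (Spec (CommRingCat.of O))} (h : (localModelFunctor hπ n r).RepresentableBy M) :
    Nonempty (Over.mk ((Utau h).ι ≫ M.hom) ≅ equationScheme π n r) := by
  have : NeZero n := ⟨by omega⟩
  have hU := isUniversalDatum_equationCoord π hr hrn
  rw [← transitionMatrix_eq_shiftMatrix hπ] at hU
  exact (isChart_of_representableBy h (tauLocus_eq_chartLocus _ _)).nonempty_iso hU.isChart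

theorem exists_isTauFamily [IsLocalRing O] {π : O} (hπ : π ≠ 0) (hπ' : ¬IsUnit π) {n r : ℕ}
    (hrn : r < n) {M : Over (Spec (CommRingCat.of O))}
    (h : (localModelFunctor hπ n r).RepresentableBy M) :
    ∃ x : geometricClosedPoint O ⟶ M, IsTauFamily (family (h.homEquiv x)) ∧
      ∀ p : (geometricClosedPoint O).left, x.left p ∈ Utau h := by
  have : NeZero n := ⟨by omega⟩
  have hn : r + (n - r) = n := Nat.add_sub_cancel' hrn.le
  have hq : 0 < n - r := Nat.sub_pos_of_lt hrn
  -- As π vanishes in the residue field, zero first columns satisfy the equations and define a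
  -- point.
  have hπ0 : structMap (geometricClosedPoint O) ⊤ π = 0 := by
    rw [geometricClosedPoint, ← structMap_spec, RingHom.comp_apply, RingHom.comp_apply,
      (IsLocalRing.residue_eq_zero_iff π).mpr ((IsLocalRing.mem_maximalIdeal π).mpr hπ'), map_zero,
      map_zero]
  have hQ := isChartDatum_zero (A := Γ((geometricClosedPoint O).left, ⊤)) hq hn hπ0
  rw [← transitionMatrix_eq_shiftMatrix hπ] at hQ
  obtain ⟨x, hx⟩ := (h.homEquiv (X := geometricClosedPoint O)).surjective
    (chartFamily (geometricClosedPoint O) _ hQ)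
  refine ⟨x, ?_, fun p => ?_⟩
  · rw [hx]
    exact isTauFamily_chartFamily hq hn hQ
  · have h1 := chartLocus_chartFamily (geometricClosedPoint O) _ hQ
    rw [← hx] at h1
    have h2 : CompatibleFamily.sub (h.homEquiv x) =
        CompatibleFamily.sub (CompatibleFamily.pullback (h.homEquiv (𝟙 M)) x) :=
      congrArg CompatibleFamily.sub (homEquiv_eq_pullback h x)
    have h3 : x.left ⁻¹ᵁ Utau h = ⊤ := by
      rw [Utau, tauLocus_eq_chartLocus hn]
      refine (chartLocus_pullback (tauEquiv hn) _ x.left).symm.trans ?_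
      exact (congrArg (chartLocus (tauEquiv hn)) h2).symm.trans h1
    exact (h3 ▸ trivial : p ∈ x.left ⁻¹ᵁ Utau h)

end Main

end LocalModel

end

theorem mainTheorem10 {O : Type u} [CommRing O] [IsDomain O] [IsDiscreteValuationRing O]
    [IsAdicComplete (IsLocalRing.maximalIdeal O) O] [PerfectField (IsLocalRing.ResidueField O)]
    (π : O) (hπ : Irreducible π) (n r : ℕ) (hr : 0 < r) (hrn : r < n) :
    (LocalModel.localModelFunctor hπ.ne_zero n r).IsRepresentable ∧
    ∀ (M : Over (Spec (CommRingCat.of O)))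
      (h : (LocalModel.localModelFunctor hπ.ne_zero n r).RepresentableBy M),
      (∃ x : LocalModel.geometricClosedPoint O ⟶ M,
        LocalModel.IsTauFamily (LocalModel.family (h.homEquiv x)) ∧
        ∀ p : (LocalModel.geometricClosedPoint O).left, x.left p ∈ LocalModel.Utau h) ∧
      Nonempty (Over.mk ((LocalModel.Utau h).ι ≫ M.hom) ≅ LocalModel.equationScheme π n r) :=
  ⟨LocalModel.isRepresentable_compatibleSubspaces _ (Nat.add_sub_cancel' hrn.le).symm, fun _ h =>
    ⟨LocalModel.exists_isTauFamily hπ.ne_zero hπ.not_isUnit hrn h,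
      LocalModel.nonempty_Utau_iso hπ.ne_zero hr hrn h⟩⟩
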